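/- Let $E$ be a CM field of degree $2g$ over $\mathbb{Q}$, with complex conjugation $\rho$, let $J=\mathrm{Hom}(E,\overline{\mathbb{Q}})$, and let $\Sigma\subset J$ be a CM type, i.e. $J$ is the disjoint union of $\Sigma$ and $\Sigma\rho$. Let $E'\subset\overline{\mathbb{Q}}$ be the reflex field of $(E,\Sigma)$, that is, the fixed field of the stabilizer of $\Sigma$ in $\mathrm{Gal}(\overline{\mathbb{Q}}/\mathbb{Q})$. For a number field $K$ let $R_K=\mathrm{Res}_{K/\mathbb{Q}}\mathbb{G}_{m,K}$, with cocharacter module $X_*(R_K)=\bigoplus_{\varphi:K\to\overline{\mathbb{Q}}}\mathbb{Z}[\varphi]$. Let $GU_E\subset R_E$ be the subtorus generated by $\mathbb{G}_{m,\mathbb{Q}}$ and $U_E=\{x\in R_E : x x^{\rho}=1\}$, i.e. $GU_E=\{x\in R_E : x x^\rho\in\mathbb{G}_m\}$, so that $$X_*(GU_E)=\Big\{\sum_{\varphi\in J} n_\varphi[\varphi] : n_\varphi+n_{\varphi\rho}\text{ does not depend on }\varphi\Big\}.$$ The cocharacter $\mu=\sum_{\varphi\in\Sigma}[\varphi]$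 of $GU_E$ is defined over $E'$; let $r=N_{E'/\mathbb{Q}}\circ\mathrm{Res}_{E'/\mathbb{Q}}(\mu):R_{E'}\to GU_E$ be the reciprocity morphism. On cocharacters it is given by $$X_*(r)([\beta])=\sum_{\varphi\in\Sigma}[\tilde\beta\circ\varphi],$$ where $\tilde\beta$ is any automorphism of $\overline{\mathbb{Q}}$ extending $\beta:E'\to\overline{\mathbb{Q}}$. Put $L_\mu=X_*(r)(X_*(R_{E'}))$ and $L'_\mu=(L_\mu\otimes\mathbb{Q})\cap X_*(GU_E)$. If $g\le 3$, then the kernel of $r$ is connected, and $L_\mu=L'_\mu$ (the two assertions being equivalent). -/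

import Mathlib

open scoped TensorProduct
open CategoryTheory NumberField

universe u v w

namespace CMTorus

noncomputable section

/-! ### Group functors on commutative `ℚ`-algebras -/

/-- A (commutative) group functor over `ℚ`, in the sense of the functor of points. -/
abbrev GroupFunctor := CommAlgCat.{u} ℚ ⥤ CommGrpCat.{u}

/-- The kernel of a homomorphism of group functors: `A ↦ ker (F(A) → G(A))`. -/
def kerFunctor {F G : GroupFunctor.{u}} (r : F ⟶ G) : GroupFunctor.{u} where
  obj A := CommGrpCat.of (r.app A).hom.ker
  map {A B} f := CommGrpCat.ofHom
    (((F.map f).hom.comp (r.app A).hom.ker.subtype).codRestrict (r.app B).hom.ker (fun x => by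
      have h := ConcreteCategory.congr_hom (r.naturality f) x.1
      have hx : (r.app A).hom x.1 = 1 := x.2
      rw [MonoidHom.mem_ker]
      change (r.app B).hom ((F.map f).hom x.1) = (G.map f).hom ((r.app A).hom x.1) at h
      change (r.app B).hom ((F.map f).hom x.1) = 1
      rw [h, hx, map_one]))
  map_id A := by ext x; exact ConcreteCategory.congr_hom (F.map_id A) x.1
  map_comp f g := by ext x; exact ConcreteCategory.congr_hom (F.map_comp f g) x.1

/-- A group functor is a connected affine group scheme if it is represented by a commutative
`ℚ`-algebra whose spectrum is a connected topological space.  (The representing algebra is unique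
up to a unique isomorphism.) -/
def IsConnectedAffineGroup (F : GroupFunctor.{u}) : Prop :=
  ∃ B : CommAlgCat.{u} ℚ, Nonempty ((F ⋙ forget CommGrpCat.{u}).CorepresentableBy B) ∧
    ConnectedSpace (PrimeSpectrum B)

/-! ### Weil restrictions and norms -/

section Norm

variable {S : Type u} [CommRing S] [Algebra ℚ S] {S' : Type v} [CommRing S'] [Algebra ℚ S']
variable (K : Type w) [Field K] [Algebra ℚ K]

/-- The map `S ⊗ K → S' ⊗ K` induced by `f : S → S'`. -/
def bc (f : S →ₐ[ℚ] S') : S ⊗[ℚ] K →ₐ[ℚ] S' ⊗[ℚ] K :=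
  Algebra.TensorProduct.map f (AlgHom.id ℚ K)

@[simp] theorem bc_tmul (f : S →ₐ[ℚ] S') (s : S) (k : K) : bc K f (s ⊗ₜ k) = f s ⊗ₜ k := by
  simp [bc]

theorem repr_bc {ι : Type*} (b : Module.Basis ι ℚ K) (f : S →ₐ[ℚ] S') (z : S ⊗[ℚ] K) (i : ι) :
    (Algebra.TensorProduct.basis S' b).repr (bc K f z) i
      = f ((Algebra.TensorProduct.basis S b).repr z i) := by
  induction z with
  | zero => simp
  | tmul s k => simp [Algebra.TensorProduct.basis_repr_tmul]
  | add x y hx hy => simp [hx, hy]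

/-- The norm `S ⊗ K → S` commutes with base change in `S`. -/
theorem norm_bc [FiniteDimensional ℚ K] (f : S →ₐ[ℚ] S') (z : S ⊗[ℚ] K) :
    Algebra.norm S' (bc K f z) = f (Algebra.norm S z) := by
  classical
  let b := Module.finBasis ℚ K
  rw [Algebra.norm_eq_matrix_det (Algebra.TensorProduct.basis S' b),
    Algebra.norm_eq_matrix_det (Algebra.TensorProduct.basis S b), AlgHom.map_det]
  congr 1
  ext i j
  rw [AlgHom.mapMatrix_apply, Matrix.map_apply, Algebra.leftMulMatrix_eq_repr_mul,
    Algebra.leftMulMatrix_eq_repr_mul, ← repr_bc]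
  simp

end Norm

/-- The Weil restriction `R_K = Res_{K/ℚ} 𝔾_m`, as a group functor: `A ↦ (A ⊗ K)ˣ`. -/
def resGm (K : Type w) [Field K] [Algebra ℚ K] : GroupFunctor.{max u w} where
  obj A := CommGrpCat.of (A ⊗[ℚ] K)ˣ
  map f := CommGrpCat.ofHom (Units.map (bc K f.hom).toMonoidHom)
  map_id A := by
    ext x
    change bc K (AlgHom.id ℚ A) x.1 = x.1
    simp [bc]
  map_comp f g := by
    ext x
    change bc K (g.hom.comp f.hom) x.1 = bc K g.hom (bc K f.hom x.1)
    generalize x.1 = z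
    induction z with
    | zero => simp
    | tmul s k => simp
    | add x y hx hy => simp [hx, hy]

/-! ### CM types and the reflex field -/

/-- The field `ℚ̄` of algebraic numbers, with its structure of algebra over `ℚ`. -/
def Qbar : Type := AlgebraicClosure ℚ

instance : Field Qbar := inferInstanceAs (Field (AlgebraicClosure ℚ))

instance : Algebra ℚ Qbar := AlgebraicClosure.instAlgebra ℚ

instance : IsAlgClosure ℚ Qbar :=
  ⟨AlgebraicClosure.isAlgClosed ℚ, AlgebraicClosure.isAlgebraic ℚ⟩

instance : IsAlgClosed Qbar := IsAlgClosure.isAlgClosed ℚ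

instance : IsGalois ℚ Qbar where
  to_isSeparable := Algebra.IsAlgebraic.isSeparable_of_perfectField
  to_normal := IsAlgClosure.normal ℚ Qbar

/-- The basis of `K` dual to a given basis for the trace form, in terms of the embeddings of `K`. -/
theorem exists_dual (K : Type w) [Field K] [Algebra ℚ K] [FiniteDimensional ℚ K] :
    ∃ b' : Fin (Module.finrank ℚ K) → K,
      (∀ i j, ∑ φ : K →ₐ[ℚ] Qbar, φ (b' i) * φ (Module.finBasis ℚ K j) = if i = j then 1 else 0) ∧
      ∀ ψ φ : K →ₐ[ℚ] Qbar,
      (ψ = φ → ∑ i, ψ (Module.finBasis ℚ K i) * φ (b' i) = 1) ∧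
      (ψ ≠ φ → ∑ i, ψ (Module.finBasis ℚ K i) * φ (b' i) = 0) := by
  classical
  let b := Module.finBasis ℚ K
  let b' := (Algebra.traceForm ℚ K).dualBasis (traceForm_nondegenerate ℚ K) b
  let P : Matrix (Fin (Module.finrank ℚ K)) (K →ₐ[ℚ] Qbar) Qbar := Matrix.of fun i φ => φ (b' i)
  let Q : Matrix (K →ₐ[ℚ] Qbar) (Fin (Module.finrank ℚ K)) Qbar := Matrix.of fun φ i => φ (b i)
  have hcard : Fintype.card (Fin (Module.finrank ℚ K)) = Fintype.card (K →ₐ[ℚ] Qbar) := by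
    rw [AlgHom.card]; simp
  have h : P * Q = 1 := by
    ext i j
    have h1 : (P * Q) i j = ∑ φ : K →ₐ[ℚ] Qbar, φ (b' i * b j) := by
      simp [Matrix.mul_apply, P, Q]
    rw [h1, ← trace_eq_sum_embeddings (K := ℚ) Qbar]
    have := LinearMap.BilinForm.apply_dualBasis_left (B := Algebra.traceForm ℚ K)
      (traceForm_nondegenerate ℚ K) b i j
    rw [Algebra.traceForm_apply] at this
    rw [this, Matrix.one_apply]
    by_cases hij : i = j <;> simp [hij, eq_comm]
  have h2 : Q * P = 1 := (Matrix.mul_eq_one_comm_of_equiv (Fintype.equivOfCardEq hcard)).1 h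
  refine ⟨b', fun i j => ?_, fun ψ φ => ?_⟩
  · have := congrFun (congrFun h i) j
    simpa [Matrix.mul_apply, Matrix.one_apply, P, Q] using this
  · have := congrFun (congrFun h2 ψ) φ
    constructor <;> intro hne <;>
      simpa [Matrix.mul_apply, Matrix.one_apply, P, Q, hne] using this

section CM

variable (E : Type u) [Field E] [NumberField E] [IsCMField E]

/-- Complex conjugation `ρ` of the CM field `E`. -/
def conj : E ≃ₐ[ℚ] E := (IsCMField.complexConj E).restrictScalars ℚ

/-- The action of complex conjugation on `J = Hom(E, ℚ̄)`: `φ ↦ φ ∘ ρ` (which is also the action of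
complex conjugation of `ℚ̄` for any embedding of `ℚ̄` in `ℂ`). -/
def conjEmb (φ : E →ₐ[ℚ] Qbar) : E →ₐ[ℚ] Qbar := φ.comp (conj E).toAlgHom

/-- A CM type on `E`: a subset `Φ` of `J` such that `J` is the disjoint union of `Φ` and `Φ^ρ`. -/
structure CMType where
  /-- the underlying set of embeddings -/
  carrier : Set (E →ₐ[ℚ] Qbar)
  union_conj : carrier ∪ conjEmb E '' carrier = Set.univ
  disjoint_conj : Disjoint carrier (conjEmb E '' carrier)

variable {E}

theorem conj_conj (x : E) : conj E (conj E x) = x := IsCMField.complexConj_apply_apply E x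

theorem conjEmb_conjEmb (φ : E →ₐ[ℚ] Qbar) : conjEmb E (conjEmb E φ) = φ := by
  ext x
  exact congrArg φ (conj_conj x)

namespace CMType

variable (Φ : CMType E)

theorem conjEmb_mem_iff (φ : E →ₐ[ℚ] Qbar) : conjEmb E φ ∈ Φ.carrier ↔ φ ∉ Φ.carrier := by
  constructor
  · intro h h'
    exact Set.disjoint_left.1 Φ.disjoint_conj h ⟨φ, h', rfl⟩
  · intro h
    have := Φ.union_conj.symm ▸ Set.mem_univ φ
    rcases this with h' | ⟨ψ, hψ, rfl⟩
    · exact absurd h' h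
    · rwa [conjEmb_conjEmb]

/-- The stabilizer of the CM type in the absolute Galois group of `ℚ` (acting on `J` by
composition). -/
def stabilizer : Subgroup (Qbar ≃ₐ[ℚ] Qbar) where
  carrier := {σ | ∀ φ : E →ₐ[ℚ] Qbar, σ.toAlgHom.comp φ ∈ Φ.carrier ↔ φ ∈ Φ.carrier}
  one_mem' := fun φ => Iff.rfl
  mul_mem' := fun {σ τ} hσ hτ φ => (hσ (τ.toAlgHom.comp φ)).trans (hτ φ)
  inv_mem' := fun {σ} hσ φ => by
    rw [← hσ]
    have : σ.toAlgHom.comp ((σ⁻¹).toAlgHom.comp φ) = φ := by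
      ext x
      exact σ.apply_symm_apply (φ x)
    rw [this]

/-- The reflex field `E'` of `(E, Φ)`: the fixed field of the stabilizer of `Φ`. -/
def reflexField : IntermediateField ℚ Qbar := IntermediateField.fixedField Φ.stabilizer

/-- The reflex field is contained in the Galois closure of `E`, hence is a number field. -/
theorem reflexField_le : Φ.reflexField ≤ IntermediateField.normalClosure ℚ E Qbar := by
  rw [← InfiniteGalois.fixedField_fixingSubgroup (IntermediateField.normalClosure ℚ E Qbar)]
  apply IntermediateField.fixedField_antitone
  intro σ hσ φ
  have : σ.toAlgHom.comp φ = φ := by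
    ext x
    exact (IntermediateField.mem_fixingSubgroup_iff _ _).1 hσ (φ x)
      (AlgHom.fieldRange_le_normalClosure φ ⟨x, rfl⟩)
  rw [this]

/-- The reflex field `E'`, as a type. -/
def ReflexField : Type := Φ.reflexField

instance : Field Φ.ReflexField := inferInstanceAs (Field Φ.reflexField)

instance : Algebra ℚ Φ.ReflexField := IntermediateField.algebra' Φ.reflexField

/-- The inclusion of the reflex field in `ℚ̄`. -/
def incl : Φ.ReflexField →ₐ[ℚ] Qbar := Φ.reflexField.val

instance : FiniteDimensional ℚ Φ.ReflexField :=
  Module.Finite.of_injective (IntermediateField.inclusion Φ.reflexField_le).toLinearMap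
    (IntermediateField.inclusion Φ.reflexField_le).injective

/-! ### The reciprocity morphism -/

/-- `a ⊗ b ↦ φ(a) b`, for an embedding `φ` of `E`. -/
def ev (φ : E →ₐ[ℚ] Qbar) : E ⊗[ℚ] Φ.ReflexField →ₐ[ℚ] Qbar :=
  Algebra.TensorProduct.productMap φ Φ.incl

@[simp] theorem ev_tmul (φ : E →ₐ[ℚ] Qbar) (a : E) (b : Φ.ReflexField) :
    Φ.ev φ (a ⊗ₜ b) = φ a * Φ.incl b := by
  rw [ev, Algebra.TensorProduct.productMap_apply_tmul]

theorem ev_ext {z z' : E ⊗[ℚ] Φ.ReflexField} (h : ∀ φ, Φ.ev φ z = Φ.ev φ z') : z = z' := by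
  rw [← sub_eq_zero]
  have h0 : ∀ φ, Φ.ev φ (z - z') = 0 := fun φ => by rw [map_sub, h, sub_self]
  generalize z - z' = y at h0
  obtain ⟨c, rfl⟩ : ∃ c : Fin (Module.finrank ℚ E) → Φ.ReflexField,
      y = ∑ i, Module.finBasis ℚ E i ⊗ₜ c i := by
    clear h0
    induction y with
    | zero => exact ⟨0, by simp⟩
    | tmul a k =>
      refine ⟨fun i => algebraMap ℚ Φ.ReflexField ((Module.finBasis ℚ E).repr a i) * k, ?_⟩
      conv_lhs => rw [← (Module.finBasis ℚ E).sum_repr a, TensorProduct.sum_tmul]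
      refine Finset.sum_congr rfl fun i _ => ?_
      change _ = _ ⊗ₜ (_ * k)
      rw [← Algebra.smul_def, TensorProduct.tmul_smul, TensorProduct.smul_tmul']
    | add x y hx hy =>
      obtain ⟨c, rfl⟩ := hx
      obtain ⟨d, rfl⟩ := hy
      exact ⟨c + d, by simp [TensorProduct.tmul_add, Finset.sum_add_distrib]⟩
  obtain ⟨b', hb0, hb⟩ := exists_dual E
  suffices hc : ∀ j, c j = 0 by simp [hc]
  intro j
  apply Φ.incl.injective
  have h1 : ∀ φ : E →ₐ[ℚ] Qbar, ∑ i, φ (Module.finBasis ℚ E i) * Φ.incl (c i) = 0 := fun φ => by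
    rw [← h0 φ, map_sum]
    exact Finset.sum_congr rfl fun i _ => (Φ.ev_tmul _ _ _).symm
  calc Φ.incl (c j) = ∑ i, (if j = i then 1 else 0) * Φ.incl (c i) := by simp
    _ = ∑ i, (∑ φ : E →ₐ[ℚ] Qbar, φ (b' j) * φ (Module.finBasis ℚ E i)) * Φ.incl (c i) := by
        simp_rw [hb0]
    _ = ∑ φ : E →ₐ[ℚ] Qbar, φ (b' j) * ∑ i, φ (Module.finBasis ℚ E i) * Φ.incl (c i) := by
        simp_rw [Finset.sum_mul, Finset.mul_sum, mul_assoc]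
        exact Finset.sum_comm
    _ = Φ.incl 0 := by simp [h1]

/-- Existence of the idempotent of `E ⊗ E'` cutting out `Φ`. -/
theorem exists_idem : ∃ e : E ⊗[ℚ] Φ.ReflexField, ∀ φ : E →ₐ[ℚ] Qbar,
    (φ ∈ Φ.carrier → Φ.ev φ e = 1) ∧ (φ ∉ Φ.carrier → Φ.ev φ e = 0) := by
  classical
  obtain ⟨b', hb0, hb⟩ := exists_dual E
  let t : E → Φ.ReflexField := fun x => ⟨∑ φ ∈ Φ.carrier.toFinset, φ x, by
    rintro ⟨σ, hσ⟩
    change σ (∑ φ ∈ Φ.carrier.toFinset, φ x) = _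
    rw [map_sum]
    refine Finset.sum_bij' (fun φ _ => σ.toAlgHom.comp φ) (fun φ _ => (σ⁻¹).toAlgHom.comp φ)
      ?_ ?_ ?_ ?_ ?_
    · intro φ hφ
      simpa using (hσ φ).2 (by simpa using hφ)
    · intro φ hφ
      simpa using (Φ.stabilizer.inv_mem hσ φ).2 (by simpa using hφ)
    · intro φ _
      ext y
      exact σ.symm_apply_apply (φ y)
    · intro φ _
      ext y
      exact σ.apply_symm_apply (φ y)
    · intro φ _
      rfl⟩
  refine ⟨∑ i, Module.finBasis ℚ E i ⊗ₜ t (b' i), fun ψ => ?_⟩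
  have key : Φ.ev ψ (∑ i, Module.finBasis ℚ E i ⊗ₜ t (b' i)) =
      ∑ φ ∈ Φ.carrier.toFinset, ∑ i, ψ (Module.finBasis ℚ E i) * φ (b' i) := by
    rw [map_sum, Finset.sum_comm]
    refine Finset.sum_congr rfl fun i _ => ?_
    rw [ev_tmul, ← Finset.mul_sum]
    rfl
  rw [key]
  constructor
  · intro h
    rw [Finset.sum_eq_single ψ (fun φ _ hne => (hb ψ φ).2 hne.symm) (by simp [h])]
    exact (hb ψ ψ).1 rfl
  · intro h
    refine Finset.sum_eq_zero fun φ hφ => (hb ψ φ).2 ?_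
    rintro rfl
    exact h (by simpa using hφ)

/-- The idempotent `e` of `E ⊗ E'` which is `1` on the factors of `E ⊗ ℚ̄ = ∏_{φ ∈ J} ℚ̄` with
`φ ∈ Φ`, and `0` on the others. -/
def idem : E ⊗[ℚ] Φ.ReflexField := Φ.exists_idem.choose

theorem ev_idem_of_mem {φ : E →ₐ[ℚ] Qbar} (h : φ ∈ Φ.carrier) : Φ.ev φ Φ.idem = 1 :=
  (Φ.exists_idem.choose_spec φ).1 h

theorem ev_idem_of_notMem {φ : E →ₐ[ℚ] Qbar} (h : φ ∉ Φ.carrier) : Φ.ev φ Φ.idem = 0 :=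
  (Φ.exists_idem.choose_spec φ).2 h

theorem idem_mul_idem : Φ.idem * Φ.idem = Φ.idem := by
  refine Φ.ev_ext fun φ => ?_
  by_cases h : φ ∈ Φ.carrier
  · simp [Φ.ev_idem_of_mem h]
  · simp [Φ.ev_idem_of_notMem h]

/-- Complex conjugation on `E ⊗ E'` (through the first factor) exchanges `e` and `1 - e`. -/
theorem conj_idem : bc Φ.ReflexField (conj E).toAlgHom Φ.idem = 1 - Φ.idem := by
  refine Φ.ev_ext fun φ => ?_
  have key : ∀ z, Φ.ev φ (bc Φ.ReflexField (conj E).toAlgHom z) = Φ.ev (conjEmb E φ) z := by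
    intro z
    induction z with
    | zero => simp
    | tmul a b => rw [bc_tmul, ev_tmul, ev_tmul]; rfl
    | add x y hx hy => rw [map_add, map_add, map_add, hx, hy]
  rw [key, map_sub, map_one]
  by_cases h : φ ∈ Φ.carrier
  · rw [Φ.ev_idem_of_mem h, Φ.ev_idem_of_notMem, sub_self]
    rw [conjEmb_mem_iff]; exact not_not.2 h
  · rw [Φ.ev_idem_of_notMem h, Φ.ev_idem_of_mem, sub_zero]
    rwa [conjEmb_mem_iff]

section Points

variable (A : Type v) [CommRing A] [Algebra ℚ A]

/-- The inclusion of `A` in `A ⊗ E`. -/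
abbrev inA : A →ₐ[ℚ] A ⊗[ℚ] E := Algebra.TensorProduct.includeLeft

/-- The inclusion of `E` in `A ⊗ E`. -/
abbrev inE : E →ₐ[ℚ] A ⊗[ℚ] E := Algebra.TensorProduct.includeRight

/-- The image of the idempotent `e` in `(A ⊗ E) ⊗ E'`. -/
def idemA : (A ⊗[ℚ] E) ⊗[ℚ] Φ.ReflexField := bc Φ.ReflexField (inE A) Φ.idem

theorem idemA_mul_idemA : Φ.idemA A * Φ.idemA A = Φ.idemA A := by
  rw [idemA, ← map_mul, idem_mul_idem]

/-- The cocharacter `μ = ∑_{φ ∈ Φ} [φ]` of `R_E`, which is defined over `E'`, on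
`(A ⊗ E')`-points: it sends `x` to `e x + (1 - e)`, that is, to `x` in the factors
indexed by `Φ` and to `1` in the others. -/
def mu : A ⊗[ℚ] Φ.ReflexField →* (A ⊗[ℚ] E) ⊗[ℚ] Φ.ReflexField where
  toFun x := Φ.idemA A * bc Φ.ReflexField (inA A) x + (1 - Φ.idemA A)
  map_one' := by simp
  map_mul' x y := by
    rw [map_mul]
    linear_combination (- (bc Φ.ReflexField (inA A) x * bc Φ.ReflexField (inA A) y
      - bc Φ.ReflexField (inA A) x - bc Φ.ReflexField (inA A) y + 1)) * Φ.idemA_mul_idemA A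

/-- The reciprocity morphism on `A`-points: the composite `(A ⊗ E')ˣ → (A ⊗ E ⊗ E')ˣ → (A ⊗ E)ˣ`
of `μ : 𝔾_m → R_E` (over `E'`) and the norm from `E'` to `ℚ`, i.e.
`r = N_{E'/ℚ} ∘ Res_{E'/ℚ}(μ)`. -/
def recPoints : (A ⊗[ℚ] Φ.ReflexField)ˣ →* (A ⊗[ℚ] E)ˣ :=
  Units.map ((Algebra.norm (A ⊗[ℚ] E)).comp (Φ.mu A))

variable {A} in
theorem conjA_mul (f : A ⊗[ℚ] E →ₐ[ℚ] A ⊗[ℚ] E)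
    (hf : f = Algebra.TensorProduct.map (AlgHom.id ℚ A) (conj E).toAlgHom)
    (x : A ⊗[ℚ] Φ.ReflexField) :
    Algebra.norm (A ⊗[ℚ] E) (Φ.mu A x) * f (Algebra.norm (A ⊗[ℚ] E) (Φ.mu A x))
      = Algebra.norm A x ⊗ₜ 1 := by
  have h1 : ∀ z, bc Φ.ReflexField f (bc Φ.ReflexField (inE A) z)
      = bc Φ.ReflexField (inE A) (bc Φ.ReflexField (conj E).toAlgHom z) := by
    intro z
    induction z with
    | zero => simp
    | tmul a b => simp [hf]
    | add x y hx hy => simp only [map_add, hx, hy]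
  have h2 : ∀ z, bc Φ.ReflexField f (bc Φ.ReflexField (inA A) z)
      = bc Φ.ReflexField (inA A) z := by
    intro z
    induction z with
    | zero => simp
    | tmul a b => simp [hf]
    | add x y hx hy => simp only [map_add, hx, hy]
  have h3 : bc Φ.ReflexField f (Φ.mu A x)
      = (1 - Φ.idemA A) * bc Φ.ReflexField (inA A) x + Φ.idemA A := by
    change bc Φ.ReflexField f (Φ.idemA A * bc Φ.ReflexField (inA A) x + (1 - Φ.idemA A)) = _
    rw [map_add, map_mul, map_sub, map_one, h2, idemA, h1, conj_idem, map_sub, map_one]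
    ring
  have h4 : Φ.mu A x * bc Φ.ReflexField f (Φ.mu A x) = bc Φ.ReflexField (inA A) x := by
    rw [h3]
    change (Φ.idemA A * bc Φ.ReflexField (inA A) x + (1 - Φ.idemA A)) * _ = _
    linear_combination (-(bc Φ.ReflexField (inA A) x - 1) ^ 2) * Φ.idemA_mul_idemA A
  rw [← norm_bc, ← map_mul, h4, norm_bc]
  rfl

end Points

end CMType

/-! ### The torus `GU_E` -/

variable (E)

/-- The action of `ρ` on `A ⊗ E`. -/
def conjA (A : Type v) [CommRing A] [Algebra ℚ A] : A ⊗[ℚ] E →ₐ[ℚ] A ⊗[ℚ] E :=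
  Algebra.TensorProduct.map (AlgHom.id ℚ A) (conj E).toAlgHom

/-- The `A`-points of the subtorus `GU_E` of `R_E` generated by `𝔾_m` and
`U_E = {x | x x^ρ = 1}`: the `x ∈ (A ⊗ E)ˣ` such that `x x^ρ ∈ Aˣ`. -/
def guPoints (A : Type v) [CommRing A] [Algebra ℚ A] : Subgroup (A ⊗[ℚ] E)ˣ where
  carrier := {x | ∃ a : Aˣ, (x : A ⊗[ℚ] E) * conjA E A x = (a : A) ⊗ₜ 1}
  one_mem' := ⟨1, by rw [Units.val_one, Units.val_one, map_one, mul_one, Algebra.TensorProduct.one_def]⟩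
  mul_mem' := by
    rintro x y ⟨a, ha⟩ ⟨b, hb⟩
    refine ⟨a * b, ?_⟩
    have : ((a * b : Aˣ) : A) ⊗ₜ[ℚ] (1 : E) = ((a : A) ⊗ₜ 1) * ((b : A) ⊗ₜ 1) := by simp
    rw [this, ← ha, ← hb, Units.val_mul, map_mul]
    ring
  inv_mem' := by
    rintro x ⟨a, ha⟩
    refine ⟨a⁻¹, ?_⟩
    have h1 : ((a⁻¹ : Aˣ) : A) ⊗ₜ[ℚ] (1 : E) * ((a : A) ⊗ₜ 1) = 1 := by
      simp [Algebra.TensorProduct.one_def]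
    have h2 : conjA E A (x : A ⊗[ℚ] E) * conjA E A ((x⁻¹ : (A ⊗[ℚ] E)ˣ) : A ⊗[ℚ] E) = 1 := by
      rw [← map_mul]; simp
    have h3 : ((x⁻¹ : (A ⊗[ℚ] E)ˣ) : A ⊗[ℚ] E) * x = 1 := by simp
    rw [← ha] at h1
    linear_combination
      (-((x⁻¹ : (A ⊗[ℚ] E)ˣ) : A ⊗[ℚ] E) * conjA E A ((x⁻¹ : (A ⊗[ℚ] E)ˣ) : A ⊗[ℚ] E)) * h1
      + (((a⁻¹ : Aˣ) : A) ⊗ₜ[ℚ] (1 : E)) * h2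
      + (((a⁻¹ : Aˣ) : A) ⊗ₜ[ℚ] (1 : E)) * conjA E A (x : A ⊗[ℚ] E)
        * conjA E A ((x⁻¹ : (A ⊗[ℚ] E)ˣ) : A ⊗[ℚ] E) * h3

theorem conjA_bc {A : Type v} [CommRing A] [Algebra ℚ A] {B : Type w} [CommRing B] [Algebra ℚ B]
    (f : A →ₐ[ℚ] B) (z : A ⊗[ℚ] E) : conjA E B (bc E f z) = bc E f (conjA E A z) := by
  induction z with
  | zero => simp
  | tmul a b => simp [conjA]
  | add x y hx hy => simp only [map_add, hx, hy]

theorem map_mem_guPoints {A : Type v} [CommRing A] [Algebra ℚ A] {B : Type w} [CommRing B]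
    [Algebra ℚ B] (f : A →ₐ[ℚ] B) {x : (A ⊗[ℚ] E)ˣ} (hx : x ∈ guPoints E A) :
    Units.map (bc E f).toMonoidHom x ∈ guPoints E B := by
  obtain ⟨a, ha⟩ := hx
  refine ⟨Units.map f.toMonoidHom a, ?_⟩
  change bc E f x.1 * conjA E B (bc E f x.1) = f a ⊗ₜ 1
  rw [conjA_bc, ← map_mul, ha, bc_tmul]

/-- The torus `GU_E`. -/
def GU : GroupFunctor.{u} where
  obj A := CommGrpCat.of (guPoints E A)
  map {A B} f := CommGrpCat.ofHom
    (((Units.map (bc E f.hom).toMonoidHom).comp (guPoints E A).subtype).codRestrict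
      (guPoints E B) (fun x => map_mem_guPoints E f.hom x.2))
  map_id A := by
    ext x
    have h := ConcreteCategory.congr_hom ((resGm E).map_id A) x.1
    exact congrArg (fun u : (A ⊗[ℚ] E)ˣ => u.val) h
  map_comp {_ _ C} f g := by
    ext x
    have h := ConcreteCategory.congr_hom ((resGm E).map_comp f g) x.1
    exact congrArg (fun u : (C ⊗[ℚ] E)ˣ => u.val) h

variable {E}

namespace CMType

variable (Φ : CMType E)

/-- The reciprocity morphism takes its values in `GU_E`. -/
theorem recPoints_mem (A : Type v) [CommRing A] [Algebra ℚ A] (x : (A ⊗[ℚ] Φ.ReflexField)ˣ) :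
    Φ.recPoints A x ∈ guPoints E A :=
  ⟨Units.map (Algebra.norm A) x, Φ.conjA_mul (conjA E A) rfl x⟩

theorem recPoints_natural {A : Type v} [CommRing A] [Algebra ℚ A] {B : Type w} [CommRing B]
    [Algebra ℚ B] (f : A →ₐ[ℚ] B) (x : (A ⊗[ℚ] Φ.ReflexField)ˣ) :
    Φ.recPoints B (Units.map (bc Φ.ReflexField f).toMonoidHom x)
      = Units.map (bc E f).toMonoidHom (Φ.recPoints A x) := by
  have h1 : bc Φ.ReflexField (bc E f) (Φ.idemA A) = Φ.idemA B := by
    rw [idemA, idemA]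
    generalize Φ.idem = z
    induction z with
    | zero => simp
    | tmul a b => simp
    | add x y hx hy => simp only [map_add, hx, hy]
  have h2 : ∀ z, bc Φ.ReflexField (bc E f) (bc Φ.ReflexField (inA A) z)
      = bc Φ.ReflexField (inA B) (bc Φ.ReflexField f z) := by
    intro z
    induction z with
    | zero => simp
    | tmul a b => simp
    | add x y hx hy => simp only [map_add, hx, hy]
  apply Units.ext
  change Algebra.norm _ (Φ.mu B (bc Φ.ReflexField f x.1))
    = bc E f (Algebra.norm _ (Φ.mu A x.1))
  rw [← norm_bc]
  congr 1
  change Φ.idemA B * bc Φ.ReflexField (inA B) (bc Φ.ReflexField f x.1) + (1 - Φ.idemA B)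
    = bc Φ.ReflexField (bc E f) (Φ.idemA A * bc Φ.ReflexField (inA A) x.1 + (1 - Φ.idemA A))
  rw [map_add, map_mul, map_sub, map_one, h1, h2]

/-- The reciprocity morphism `r : R_{E'} → GU_E` of `(E, Φ)`. -/
def reciprocity : resGm.{u} Φ.ReflexField ⟶ GU E where
  app A := CommGrpCat.ofHom ((Φ.recPoints A).codRestrict (guPoints E A) (Φ.recPoints_mem A))
  naturality {A B} f := by
    ext x
    exact Subtype.ext (Φ.recPoints_natural f.hom x)

end CMType

/-! ### Cocharacters -/

/-- The cocharacter module `X_*(R_K) = ⨁_{φ : K → ℚ̄} ℤ [φ]` of `R_K`. -/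
abbrev Cochar (K : Type w) [Field K] [Algebra ℚ K] : Type w := (K →ₐ[ℚ] Qbar) →₀ ℤ

variable (E) in
/-- The cocharacter module `X_*(GU_E)`: the `∑ n_φ [φ]` for which `n_φ + n_{φρ}` does not depend
on `φ`. -/
def cocharGU : Submodule ℤ (Cochar E) where
  carrier := {n | ∀ φ ψ, n φ + n (conjEmb E φ) = n ψ + n (conjEmb E ψ)}
  zero_mem' := by simp
  add_mem' := by
    intro a b ha hb φ ψ
    simp only [Finsupp.add_apply]
    linear_combination ha φ ψ + hb φ ψ
  smul_mem' := by
    intro c a ha φ ψ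
    simp only [Finsupp.smul_apply, smul_eq_mul]
    linear_combination c * ha φ ψ

namespace CMType

variable (Φ : CMType E)

/-- The translate `β Φ` of the CM type by an embedding `β` of the reflex field: the set of all
`σ ∘ α`, for `α ∈ Φ` and `σ` an automorphism of `ℚ̄` that induces `β` on `E'`. -/
def translate (β : Φ.ReflexField →ₐ[ℚ] Qbar) : Set (E →ₐ[ℚ] Qbar) :=
  {φ | ∃ σ : Qbar ≃ₐ[ℚ] Qbar, (∀ x, σ (Φ.incl x) = β x) ∧
    ∃ α ∈ Φ.carrier, φ = σ.toAlgHom.comp α}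

open Classical in
/-- The map `X_*(r) : X_*(R_{E'}) → X_*(R_E)` induced by the reciprocity morphism,
`[β] ↦ ∑_{φ ∈ βΦ} [φ]`. -/
def cocharRec : Cochar Φ.ReflexField →ₗ[ℤ] Cochar E :=
  Finsupp.linearCombination ℤ fun β => ∑ φ ∈ (Φ.translate β).toFinset, Finsupp.single φ 1

/-- `L_μ = X_*(r)(X_*(R_{E'}))`. -/
def Lmu : Submodule ℤ (Cochar E) := LinearMap.range Φ.cocharRec

/-- The inclusion of `X_*(R_E)` in `X_*(R_E) ⊗ ℚ`. -/
def toRat : Cochar E →ₗ[ℤ] ((E →ₐ[ℚ] Qbar) →₀ ℚ) :=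
  Finsupp.mapRange.linearMap (Int.castAddHom ℚ).toIntLinearMap

/-- `L'_μ = (L_μ ⊗ ℚ) ∩ X_*(GU_E)`. -/
def LmuSat : Submodule ℤ (Cochar E) :=
  ((Submodule.span ℚ (toRat '' (Φ.Lmu : Set (Cochar E)))).restrictScalars ℤ).comap toRat
    ⊓ cocharGU E

end CMType

/-! ### The reciprocity morphism over `ℚ̄`

Over a `ℚ̄`-algebra `A` one has `A ⊗ K = ∏_φ A`, and the reciprocity morphism is given in these
coordinates by the matrix of `X_*(r)`. -/

section Split

variable {A : Type v} [CommRing A] [Algebra ℚ A] (ι : Qbar →ₐ[ℚ] A)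

/-- The coordinate `A ⊗ K → A` indexed by `φ : K → ℚ̄`. -/
def coord {K : Type w} [Field K] [Algebra ℚ K] (φ : K →ₐ[ℚ] Qbar) : A ⊗[ℚ] K →ₐ[ℚ] A :=
  Algebra.TensorProduct.productMap (AlgHom.id ℚ A) (ι.comp φ)

@[simp] theorem coord_tmul {K : Type w} [Field K] [Algebra ℚ K] (φ : K →ₐ[ℚ] Qbar) (a : A)
    (k : K) : coord ι φ (a ⊗ₜ k) = a * ι (φ k) := by
  rw [coord, Algebra.TensorProduct.productMap_apply_tmul]
  rfl

/-- The norm `A ⊗ K → A` is the product of the coordinates. -/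
theorem norm_eq_prod_coord (K : Type w) [Field K] [Algebra ℚ K] [FiniteDimensional ℚ K]
    (z : A ⊗[ℚ] K) : Algebra.norm A z = ∏ φ : K →ₐ[ℚ] Qbar, coord ι φ z := by
  classical
  obtain ⟨b', hb0, hb⟩ := exists_dual K
  let b := Module.finBasis ℚ K
  let B := Algebra.TensorProduct.basis A b
  let Q : Matrix (K →ₐ[ℚ] Qbar) (Fin (Module.finrank ℚ K)) A := Matrix.of fun φ i => ι (φ (b i))
  let P : Matrix (Fin (Module.finrank ℚ K)) (K →ₐ[ℚ] Qbar) A := Matrix.of fun i φ => ι (φ (b' i))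
  let M := Algebra.leftMulMatrix B z
  let D : Matrix (K →ₐ[ℚ] Qbar) (K →ₐ[ℚ] Qbar) A := Matrix.diagonal fun φ => coord ι φ z
  have hPQ : P * Q = 1 := by
    ext i j
    have := congrArg ι (hb0 i j)
    simp only [map_sum, map_mul] at this
    rw [Matrix.mul_apply, Matrix.one_apply]
    refine this.trans ?_
    split_ifs <;> simp
  have hQM : Q * M = D * Q := by
    ext φ j
    have h1 : coord ι φ (z * B j) = coord ι φ z * ι (φ (b j)) := by
      rw [map_mul]; simp [B]
    have h2 : z * B j = ∑ i, M i j • B i := by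
      rw [← B.sum_repr (z * B j)]
      simp [M, Algebra.leftMulMatrix_eq_repr_mul]
    rw [Matrix.diagonal_mul, Matrix.mul_apply]
    change _ = coord ι φ z * ι (φ (b j))
    rw [← h1, h2, map_sum]
    refine Finset.sum_congr rfl fun i _ => ?_
    simp [B, Q, TensorProduct.smul_tmul', mul_comm]
  have hM : M = P * D * Q := by
    rw [Matrix.mul_assoc, ← hQM, ← Matrix.mul_assoc, hPQ, Matrix.one_mul]
  have hcard : Fintype.card (Fin (Module.finrank ℚ K)) = Fintype.card (K →ₐ[ℚ] Qbar) := by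
    rw [AlgHom.card]; simp
  let eq := Fintype.equivOfCardEq hcard
  have hQP : Q * P = 1 := (Matrix.mul_eq_one_comm_of_equiv eq).1 hPQ
  rw [Algebra.norm_eq_matrix_det B]
  change M.det = _
  rw [hM, Matrix.det_conj_of_mul_eq_one hPQ hQP, Matrix.det_diagonal]

namespace CMType

variable (Φ : CMType E)

/-- Every embedding of the reflex field extends to an automorphism of `ℚ̄`. -/
theorem exists_extend (β : Φ.ReflexField →ₐ[ℚ] Qbar) :
    ∃ σ : Qbar ≃ₐ[ℚ] Qbar, ∀ x, σ (Φ.incl x) = β x := by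
  let β' : Φ.reflexField →ₐ[ℚ] Qbar := β
  have : Algebra.IsAlgebraic Φ.reflexField Qbar := Algebra.IsAlgebraic.tower_top (K := ℚ) _
  obtain ⟨τ, hτ⟩ := IsAlgClosed.surjective_domRestrict_of_isAlgebraic
    (K := ℚ) (L := Φ.reflexField) (E := Qbar) (M := Qbar) β'
  exact ⟨AlgEquiv.ofBijective τ (Algebra.IsAlgebraic.algHom_bijective τ),
    fun x => DFunLike.congr_fun hτ x⟩

theorem coord_idemA (φ : E →ₐ[ℚ] Qbar) (β : Φ.ReflexField →ₐ[ℚ] Qbar) :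
    (φ ∈ Φ.translate β → coord ι β (bc Φ.ReflexField (coord ι φ) (Φ.idemA A)) = 1) ∧
    (φ ∉ Φ.translate β → coord ι β (bc Φ.ReflexField (coord ι φ) (Φ.idemA A)) = 0) := by
  have key : ∀ (σ : Qbar ≃ₐ[ℚ] Qbar), (∀ x, σ (Φ.incl x) = β x) → ∀ (α : E →ₐ[ℚ] Qbar),
      φ = σ.toAlgHom.comp α → ∀ z : E ⊗[ℚ] Φ.ReflexField,
      coord ι β (bc Φ.ReflexField (coord ι φ) (bc Φ.ReflexField (inE A) z))
        = ι (σ (Φ.ev α z)) := by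
    rintro σ hσ α rfl z
    induction z with
    | zero => simp
    | tmul a b => simp [hσ]
    | add x y hx hy => simp only [map_add, hx, hy]
  constructor
  · rintro ⟨σ, hσ, α, hα, h⟩
    rw [idemA, key σ hσ α h, Φ.ev_idem_of_mem hα, map_one, map_one]
  · intro h
    obtain ⟨σ, hσ⟩ := Φ.exists_extend β
    have h1 : φ = σ.toAlgHom.comp ((σ⁻¹).toAlgHom.comp φ) := by
      ext x
      exact (σ.apply_symm_apply (φ x)).symm
    rw [idemA, key σ hσ _ h1, Φ.ev_idem_of_notMem, map_zero, map_zero]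
    exact fun h2 => h ⟨σ, hσ, _, h2, h1⟩

open Classical in
/-- In coordinates, `r(x)_φ = ∏_{β : φ ∈ βΦ} x_β`: the morphism `r` induces `[β] ↦ ∑_{φ ∈ βΦ} [φ]`
on cocharacters. -/
theorem coord_recPoints (φ : E →ₐ[ℚ] Qbar) (x : (A ⊗[ℚ] Φ.ReflexField)ˣ) :
    coord ι φ (Φ.recPoints A x) = ∏ β with φ ∈ Φ.translate β, coord ι β (x : A ⊗[ℚ] _) := by
  have h2 : ∀ z, bc Φ.ReflexField (coord ι φ) (bc Φ.ReflexField (inA A) z) = z := by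
    intro z
    induction z with
    | zero => simp
    | tmul a b => simp
    | add x y hx hy => simp only [map_add, hx, hy]
  change coord ι φ (Algebra.norm _ (Φ.mu A x)) = _
  rw [← norm_bc, norm_eq_prod_coord ι, Finset.prod_filter]
  refine Finset.prod_congr rfl fun β _ => ?_
  change coord ι β (bc Φ.ReflexField (coord ι φ)
    (Φ.idemA A * bc Φ.ReflexField (inA A) x.1 + (1 - Φ.idemA A))) = _
  rw [map_add, map_mul, map_sub, map_one, h2, map_add, map_mul, map_sub, map_one]
  split_ifs with h
  · rw [(Φ.coord_idemA ι φ β).1 h]; ring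
  · rw [(Φ.coord_idemA ι φ β).2 h]; ring

end CMType

end Split

end CM
end
end CMTorus

/-!
The proof has two independent halves.

*The lattice.* Choosing one coordinate in each pair `{φ, φρ}` with `φ ∈ Φ`, the translates of `Φ` by
the Galois group are subsets of a set with `g ≤ 3` elements, and the family of translates is stable
under complementation, because complex conjugation acts on `J` as `φ ↦ φρ`.  Up to complementation
a subset of a set with at most three elements has at most one element.  Hence `L_μ` is spanned by
`[Φ]`, `[Φρ]` and some of the differences `[φ] - [φρ]` with `φ ∈ Φ` (`diff_mem_Lmu`).  This says
that `L_μ` is the set of all `n` in `X_*(GU_E)` that are constant on the `φ ∈ Φ` whose difference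
does not occur, a condition that does not change under saturation (`Lmu_eq_LmuSat`).

*The kernel.* If `L_μ` is saturated, it is a direct summand of `X_*(R_E)`; by duality the image of
the transposed map on characters is saturated (`mem_range_charRec_of_smul_mem`), and the cokernel
`X^*(ker r)` is torsion-free.  The kernel is represented by an explicit quotient `KerAlg` of a
polynomial ring (`kerFunctor_corepresentableBy`).  Over `ℚ̄`-algebras the points of the kernel
are given in coordinates by homomorphisms from `X^*(ker r)`, so that they all come from one generic
point over the group algebra `ℚ̄[X^*(ker r)]` (`exists_generic_point`).  Comparing this point with
the universal point of `KerAlg`, one sees that `KerAlg` embeds in this group algebra, which is a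
domain since the group is torsion-free.  So `KerAlg` is a domain, and its spectrum is irreducible.
-/

namespace CMTorus

/-! ### Complex conjugation on the algebraic numbers -/

section CM

variable {E : Type u} [Field E] [NumberField E] [IsCMField E]

variable (E) in
/-- Complex conjugation of `ℚ̄`, for any embedding of `ℚ̄` in `ℂ`, acts on the embeddings of a CM
field as `conjEmb`. -/
theorem exists_complexConj :
    ∃ c : Qbar ≃ₐ[ℚ] Qbar, ∀ φ : E →ₐ[ℚ] Qbar, c.toAlgHom.comp φ = conjEmb E φ := by
  let j : Qbar →ₐ[ℚ] ℂ := IsAlgClosed.lift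
  let _ : Algebra Qbar ℂ := j.toRingHom.toAlgebra
  have : IsScalarTower ℚ Qbar ℂ := IsScalarTower.of_algHom j
  let s : ℂ ≃ₐ[ℚ] ℂ := Complex.conjAe.restrictScalars ℚ
  refine ⟨s.restrictNormal Qbar, fun φ => AlgHom.ext fun x => j.injective ?_⟩
  have h1 : j (s.restrictNormal Qbar (φ x)) = s (j (φ x)) := s.restrictNormal_commutes Qbar (φ x)
  have h2 := IsCMField.complexEmbedding_complexConj E (j.comp φ).toRingHom x
  exact h1.trans h2.symm

namespace CMType

variable (Φ : CMType E)

/-! ### Translates of the CM type -/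

/-- The translate `βΦ` is `σΦ` for each extension `σ` of `β`; that is, an automorphism that fixes
the reflex field stabilizes `Φ`. -/
theorem mem_translate_iff {β : Φ.ReflexField →ₐ[ℚ] Qbar} {σ : Qbar ≃ₐ[ℚ] Qbar}
    (hσ : ∀ x, σ (Φ.incl x) = β x) (α : E →ₐ[ℚ] Qbar) :
    σ.toAlgHom.comp α ∈ Φ.translate β ↔ α ∈ Φ.carrier := by
  refine ⟨?_, fun h => ⟨σ, hσ, α, h, rfl⟩⟩
  rintro ⟨τ, hτ, α', hα', h⟩
  by_contra hα
  -- the idempotent of `Φ` has value `σ 0` and value `τ 1` at the same embedding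
  have key : ∀ z : E ⊗[ℚ] Φ.ReflexField, σ (Φ.ev α z) = τ (Φ.ev α' z) := by
    intro z
    induction z with
    | zero => simp
    | tmul a b =>
      have ha : σ (α a) = τ (α' a) := DFunLike.congr_fun h a
      rw [ev_tmul, ev_tmul, map_mul, map_mul, hσ, hτ, ha]
    | add x y hx hy => simp only [map_add, hx, hy]
  have := key Φ.idem
  rw [Φ.ev_idem_of_notMem hα, Φ.ev_idem_of_mem hα', map_zero, map_one] at this
  exact zero_ne_one this

theorem translate_incl : Φ.translate Φ.incl = Φ.carrier :=
  Set.ext fun α => Φ.mem_translate_iff (σ := AlgEquiv.refl) (fun _ => rfl) α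

theorem conjEmb_mem_translate_iff (β : Φ.ReflexField →ₐ[ℚ] Qbar) (φ : E →ₐ[ℚ] Qbar) :
    conjEmb E φ ∈ Φ.translate β ↔ φ ∉ Φ.translate β := by
  obtain ⟨σ, hσ⟩ := Φ.exists_extend β
  obtain ⟨α, rfl⟩ : ∃ α, φ = σ.toAlgHom.comp α :=
    ⟨(σ⁻¹).toAlgHom.comp φ, AlgHom.ext fun x => (σ.apply_symm_apply (φ x)).symm⟩
  have h : conjEmb E (σ.toAlgHom.comp α) = σ.toAlgHom.comp (conjEmb E α) := rfl
  rw [h, Φ.mem_translate_iff hσ, Φ.mem_translate_iff hσ, conjEmb_mem_iff]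

/-- The translates of a CM type are stable under complex conjugation. -/
theorem exists_translate_compl (β : Φ.ReflexField →ₐ[ℚ] Qbar) :
    ∃ β' : Φ.ReflexField →ₐ[ℚ] Qbar, ∀ φ, φ ∈ Φ.translate β' ↔ φ ∉ Φ.translate β := by
  obtain ⟨c, hc⟩ := exists_complexConj E
  obtain ⟨σ, hσ⟩ := Φ.exists_extend β
  refine ⟨c.toAlgHom.comp β, fun φ => ?_⟩
  obtain ⟨α, rfl⟩ : ∃ α, φ = (c * σ).toAlgHom.comp α :=
    ⟨((c * σ)⁻¹).toAlgHom.comp φ,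
      AlgHom.ext fun x => ((c * σ).apply_symm_apply (φ x)).symm⟩
  have hcσ : ∀ x, (c * σ) (Φ.incl x) = c.toAlgHom.comp β x := fun x => congrArg c (hσ x)
  rw [Φ.mem_translate_iff hcσ]
  have h : (c * σ).toAlgHom.comp α = conjEmb E (σ.toAlgHom.comp α) := hc (σ.toAlgHom.comp α)
  rw [h, conjEmb_mem_translate_iff, not_not, Φ.mem_translate_iff hσ]

/-! ### The lattice spanned by the translates -/

open Classical in
theorem cocharRec_single_apply (β : Φ.ReflexField →ₐ[ℚ] Qbar) (φ : E →ₐ[ℚ] Qbar) :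
    Φ.cocharRec (Finsupp.single β 1) φ = if φ ∈ Φ.translate β then 1 else 0 := by
  rw [cocharRec, Finsupp.linearCombination_single, one_smul, Finsupp.finsetSum_apply]
  simp [Finsupp.single_apply]

theorem cocharRec_single_mem (β : Φ.ReflexField →ₐ[ℚ] Qbar) :
    Φ.cocharRec (Finsupp.single β 1) ∈ Φ.Lmu := ⟨_, rfl⟩

theorem Lmu_eq_span :
    Φ.Lmu = Submodule.span ℤ (Set.range fun β => Φ.cocharRec (Finsupp.single β 1)) := by
  rw [Lmu, cocharRec, Finsupp.range_linearCombination]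
  simp

theorem Lmu_le_cocharGU : Φ.Lmu ≤ cocharGU E := by
  classical
  rw [Lmu_eq_span, Submodule.span_le]
  rintro _ ⟨β, rfl⟩ φ ψ
  simp only [cocharRec_single_apply, conjEmb_mem_translate_iff]
  split_ifs <;> simp

theorem Lmu_le_LmuSat : Φ.Lmu ≤ Φ.LmuSat := fun n hn =>
  ⟨Submodule.subset_span ⟨n, hn, rfl⟩, Φ.Lmu_le_cocharGU hn⟩

/-- If `L_μ = L'_μ`, then `X_*(R_E) / L_μ` is torsion-free. -/
theorem mem_Lmu_of_smul_mem (h : Φ.Lmu = Φ.LmuSat) {k : ℤ} (hk : k ≠ 0) {n : Cochar E}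
    (hn : k • n ∈ Φ.Lmu) : n ∈ Φ.Lmu := by
  rw [h]
  refine ⟨?_, fun φ ψ => ?_⟩
  · change toRat n ∈ Submodule.span ℚ (toRat '' (Φ.Lmu : Set (Cochar E)))
    have h1 : toRat n = (k : ℚ)⁻¹ • toRat (k • n) := by
      rw [map_smul, ← Int.cast_smul_eq_zsmul ℚ k, inv_smul_smul₀ (by exact_mod_cast hk)]
    rw [h1]
    exact Submodule.smul_mem _ _ (Submodule.subset_span ⟨_, hn, rfl⟩)
  · have := Φ.Lmu_le_cocharGU hn φ ψ
    simp only [Finsupp.smul_apply, smul_eq_mul] at this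
    exact mul_left_cancel₀ hk (by linear_combination this)

/-- An element of `X_*(GU_E)` is determined by its coordinates in `Φ` and by the common value of
the sums `n_φ + n_{φρ}`. -/
theorem ext_of_mem_cocharGU {m n : Cochar E} (hm : m ∈ cocharGU E) (hn : n ∈ cocharGU E)
    {φ₀ : E →ₐ[ℚ] Qbar} (h₀ : m φ₀ + m (conjEmb E φ₀) = n φ₀ + n (conjEmb E φ₀))
    (h : ∀ φ ∈ Φ.carrier, m φ = n φ) : m = n := by
  have h1 : ∀ φ ∈ Φ.carrier, m (conjEmb E φ) = n (conjEmb E φ) := fun φ hφ => by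
    linear_combination hm φ φ₀ - hn φ φ₀ + h₀ - h φ hφ
  ext φ
  by_cases hφ : φ ∈ Φ.carrier
  · exact h φ hφ
  · have := h1 _ ((Φ.conjEmb_mem_iff φ).2 hφ)
    rwa [conjEmb_conjEmb] at this

/-- The cocharacter `[φ] - [φρ]` of `GU_E`. -/
noncomputable def diff (φ : E →ₐ[ℚ] Qbar) : Cochar E :=
  Finsupp.single φ 1 - Finsupp.single (conjEmb E φ) 1

open Classical in
theorem diff_apply {φ ψ : E →ₐ[ℚ] Qbar} (hφ : φ ∈ Φ.carrier) (hψ : ψ ∈ Φ.carrier) :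
    diff φ ψ = if ψ = φ then 1 else 0 := by
  have : conjEmb E φ ≠ ψ := fun h => (Φ.conjEmb_mem_iff φ).1 (h ▸ hψ) hφ
  simp [diff, Finsupp.single_apply, this, eq_comm]

theorem diff_add_conj (φ ψ : E →ₐ[ℚ] Qbar) : diff φ ψ + diff φ (conjEmb E ψ) = 0 := by
  classical
  have h1 : conjEmb E φ = ψ ↔ φ = conjEmb E ψ :=
    ⟨fun h => by rw [← h, conjEmb_conjEmb], fun h => by rw [h, conjEmb_conjEmb]⟩
  have h2 : conjEmb E φ = conjEmb E ψ ↔ φ = ψ :=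
    ⟨fun h => by rw [← conjEmb_conjEmb φ, h, conjEmb_conjEmb], fun h => by rw [h]⟩
  simp only [diff, Finsupp.sub_apply, Finsupp.single_apply, h1, h2]
  ring

theorem diff_mem_cocharGU (φ : E →ₐ[ℚ] Qbar) : diff φ ∈ cocharGU E := fun ψ χ => by
  rw [diff_add_conj, diff_add_conj]

/-- If the elements of `Φ` are in the translate `βΦ` with the exception of `φ`, then `[φ] - [φρ]`
is the difference of `[Φ]` and `[βΦ]`. -/
theorem diff_mem_Lmu {β : Φ.ReflexField →ₐ[ℚ] Qbar} {φ : E →ₐ[ℚ] Qbar} (hφ : φ ∈ Φ.carrier)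
    (h : ∀ ψ ∈ Φ.carrier, ψ ∉ Φ.translate β ↔ ψ = φ) : diff φ ∈ Φ.Lmu := by
  classical
  have key : diff φ = Φ.cocharRec (Finsupp.single Φ.incl 1) - Φ.cocharRec (Finsupp.single β 1) := by
    refine Φ.ext_of_mem_cocharGU (diff_mem_cocharGU φ)
      (sub_mem (Φ.Lmu_le_cocharGU (Φ.cocharRec_single_mem _))
        (Φ.Lmu_le_cocharGU (Φ.cocharRec_single_mem _))) (φ₀ := φ) ?_ fun ψ hψ => ?_
    · rw [diff_add_conj]
      simp only [Finsupp.sub_apply, cocharRec_single_apply, conjEmb_mem_translate_iff]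
      split_ifs <;> simp
    · rw [Φ.diff_apply hφ hψ, Finsupp.sub_apply, cocharRec_single_apply, cocharRec_single_apply,
        translate_incl, if_pos hψ, ← h ψ hψ]
      split_ifs <;> simp_all
  rw [key]
  exact sub_mem (Φ.cocharRec_single_mem _) (Φ.cocharRec_single_mem _)

theorem ncard_carrier {g : ℕ} (hE : Module.finrank ℚ E = 2 * g) : Φ.carrier.ncard = g := by
  have h1 : (conjEmb E '' Φ.carrier).ncard = Φ.carrier.ncard :=
    Set.ncard_image_of_injective _ (Function.LeftInverse.injective conjEmb_conjEmb)
  have h2 := Set.ncard_union_eq Φ.disjoint_conj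
  rw [Φ.union_conj, h1, Set.ncard_univ, Nat.card_eq_fintype_card, AlgHom.card, hE] at h2
  lia

/-- If `g ≤ 3`, then a translate that contains some but not all elements of `Φ` contains exactly
one or all but one of them: otherwise `Φ` has four elements. -/
theorem translate_cases {g : ℕ} (hE : Module.finrank ℚ E = 2 * g) (hg : g ≤ 3)
    (β : Φ.ReflexField →ₐ[ℚ] Qbar) {φ ψ : E →ₐ[ℚ] Qbar} (hφ : φ ∈ Φ.carrier)
    (hψ : ψ ∈ Φ.carrier) (hφβ : φ ∈ Φ.translate β) (hψβ : ψ ∉ Φ.translate β) :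
    (∀ χ ∈ Φ.carrier, χ ∈ Φ.translate β ↔ χ = φ) ∨
      ∀ χ ∈ Φ.carrier, χ ∉ Φ.translate β ↔ χ = ψ := by
  by_contra! h
  obtain ⟨⟨χ, hχ, h1⟩, θ, hθ, h2⟩ := h
  have hχ' : χ ∈ Φ.translate β ∧ χ ≠ φ := by
    by_cases hχφ : χ = φ
    · subst hχφ; simp_all
    · simp_all
  have hθ' : θ ∉ Φ.translate β ∧ θ ≠ ψ := by
    by_cases hθψ : θ = ψ
    · subst hθψ; simp_all
    · simp_all
  classical
  have h4 : ({φ, χ, ψ, θ} : Finset (E →ₐ[ℚ] Qbar)).card = 4 := by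
    have h5 : φ ≠ ψ := fun h => hψβ (h ▸ hφβ)
    have h6 : φ ≠ θ := fun h => hθ'.1 (h ▸ hφβ)
    have h7 : χ ≠ ψ := fun h => hψβ (h ▸ hχ'.1)
    have h8 : χ ≠ θ := fun h => hθ'.1 (h ▸ hχ'.1)
    simp [Finset.card_insert_of_notMem, hχ'.2.symm, hθ'.2.symm, h5, h6, h7, h8]
  have h9 := Set.ncard_le_ncard (s := (({φ, χ, ψ, θ} : Finset (E →ₐ[ℚ] Qbar)) : Set _))
    (t := Φ.carrier) (by simp [Set.insert_subset_iff, *])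
  rw [Set.ncard_coe_finset, h4, Φ.ncard_carrier hE] at h9
  lia

/-- A translate that separates two elements of `Φ` isolates one of them, possibly after complex
conjugation, and then `diff_mem_Lmu` applies. -/
theorem mem_translate_of_diff_notMem {g : ℕ} (hE : Module.finrank ℚ E = 2 * g) (hg : g ≤ 3)
    (β : Φ.ReflexField →ₐ[ℚ] Qbar) {φ ψ : E →ₐ[ℚ] Qbar} (hφ : φ ∈ Φ.carrier)
    (hψ : ψ ∈ Φ.carrier) (hφL : diff φ ∉ Φ.Lmu) (hψL : diff ψ ∉ Φ.Lmu) :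
    φ ∈ Φ.translate β → ψ ∈ Φ.translate β := by
  intro hφβ
  by_contra hψβ
  rcases Φ.translate_cases hE hg β hφ hψ hφβ hψβ with h | h
  · obtain ⟨β', hβ'⟩ := Φ.exists_translate_compl β
    exact hφL (Φ.diff_mem_Lmu (β := β') hφ fun χ hχ => by rw [hβ', not_not, h χ hχ])
  · exact hψL (Φ.diff_mem_Lmu hψ h)

/-- If `g ≤ 3`, then the elements of `L'_μ` are constant on the set of all `φ ∈ Φ` such that
`[φ] - [φρ]` is not in `L_μ`. -/
theorem apply_eq_of_mem_LmuSat {g : ℕ} (hE : Module.finrank ℚ E = 2 * g) (hg : g ≤ 3)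
    {n : Cochar E} (hn : n ∈ Φ.LmuSat) {φ ψ : E →ₐ[ℚ] Qbar} (hφ : φ ∈ Φ.carrier)
    (hψ : ψ ∈ Φ.carrier) (hφL : diff φ ∉ Φ.Lmu) (hψL : diff ψ ∉ Φ.Lmu) : n φ = n ψ := by
  classical
  have h1 : Φ.Lmu ≤ LinearMap.ker (Finsupp.lapply (R := ℤ) (M := ℤ) φ - Finsupp.lapply ψ) := by
    rw [Lmu_eq_span, Submodule.span_le]
    rintro _ ⟨β, rfl⟩
    have h2 : φ ∈ Φ.translate β ↔ ψ ∈ Φ.translate β :=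
      ⟨Φ.mem_translate_of_diff_notMem hE hg β hφ hψ hφL hψL,
        Φ.mem_translate_of_diff_notMem hE hg β hψ hφ hψL hφL⟩
    simp [cocharRec_single_apply, h2]
  have h3 : Submodule.span ℚ (toRat '' (Φ.Lmu : Set (Cochar E))) ≤
      LinearMap.ker (Finsupp.lapply (R := ℚ) (M := ℚ) φ - Finsupp.lapply ψ) := by
    rw [Submodule.span_le]
    rintro _ ⟨m, hm, rfl⟩
    have h4 : m φ - m ψ = 0 := h1 hm
    have h5 : (m φ : ℚ) - m ψ = 0 := by exact_mod_cast h4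
    exact h5
  have h6 : (n φ : ℚ) - n ψ = 0 := h3 hn.1
  exact_mod_cast sub_eq_zero.1 h6

theorem Lmu_eq_LmuSat {g : ℕ} (hE : Module.finrank ℚ E = 2 * g) (hg : g ≤ 3) :
    Φ.Lmu = Φ.LmuSat := by
  classical
  refine le_antisymm Φ.Lmu_le_LmuSat fun n hn => ?_
  have hne : (Φ.carrier).Nonempty := by
    rw [← Set.ncard_pos, Φ.ncard_carrier hE]
    have := Module.finrank_pos (R := ℚ) (M := E)
    lia
  obtain ⟨φ₁, hφ₁⟩ := hne
  obtain ⟨β, hβ⟩ := Φ.exists_translate_compl Φ.incl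
  rw [translate_incl] at hβ
  -- the value of `n` on the `φ ∈ Φ` with `[φ] - [φρ] ∉ L_μ`; arbitrary if there are none
  obtain ⟨a, ha⟩ : ∃ a, ∀ φ ∈ Φ.carrier, diff φ ∉ Φ.Lmu → n φ = a := by
    by_cases h : ∃ φ₀ ∈ Φ.carrier, diff φ₀ ∉ Φ.Lmu
    · obtain ⟨φ₀, h₀, h₀L⟩ := h
      exact ⟨n φ₀, fun φ hφ hφL => Φ.apply_eq_of_mem_LmuSat hE hg hn hφ h₀ hφL h₀L⟩
    · exact ⟨0, fun φ hφ hφL => absurd ⟨φ, hφ, hφL⟩ h⟩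
  -- the value of `n` on the conjugates of these `φ`
  let b := n φ₁ + n (conjEmb E φ₁) - a
  let m : Cochar E := a • Φ.cocharRec (Finsupp.single Φ.incl 1)
    + b • Φ.cocharRec (Finsupp.single β 1)
    + ∑ φ ∈ Φ.carrier.toFinset with diff φ ∈ Φ.Lmu, (n φ - a) • diff φ
  have hm : m ∈ Φ.Lmu := by
    refine add_mem (add_mem ?_ ?_) (sum_mem fun φ hφ => ?_)
    · exact Submodule.smul_mem _ _ (Φ.cocharRec_single_mem _)
    · exact Submodule.smul_mem _ _ (Φ.cocharRec_single_mem _)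
    · exact Submodule.smul_mem _ _ (Finset.mem_filter.1 hφ).2
  suffices h : n = m from h ▸ hm
  refine Φ.ext_of_mem_cocharGU hn.2 (Φ.Lmu_le_cocharGU hm) (φ₀ := φ₁) ?_ fun φ hφ => ?_
  · have h1 : ∑ φ ∈ Φ.carrier.toFinset with diff φ ∈ Φ.Lmu, (n φ - a) * diff φ φ₁
        + ∑ φ ∈ Φ.carrier.toFinset with diff φ ∈ Φ.Lmu, (n φ - a) * diff φ (conjEmb E φ₁) = 0 := by
      rw [← Finset.sum_add_distrib]
      exact Finset.sum_eq_zero fun φ _ => by rw [← mul_add, diff_add_conj, mul_zero]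
    have h2 : conjEmb E φ₁ ∉ Φ.carrier := fun h => (Φ.conjEmb_mem_iff φ₁).1 h hφ₁
    simp only [m, Finsupp.add_apply, Finsupp.smul_apply, Finsupp.finsetSum_apply, smul_eq_mul,
      cocharRec_single_apply, translate_incl, hβ, hφ₁, h2, not_true, not_false_iff, if_true,
      if_false]
    linear_combination -h1
  · have h1 : ∑ ψ ∈ Φ.carrier.toFinset with diff ψ ∈ Φ.Lmu, (n ψ - a) * diff ψ φ = n φ - a := by
      have h2 : ∀ ψ ∈ Φ.carrier.toFinset.filter (diff · ∈ Φ.Lmu),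
          (n ψ - a) * diff ψ φ = if φ = ψ then n ψ - a else 0 := fun ψ hψ => by
        rw [Φ.diff_apply (by simpa using (Finset.mem_filter.1 hψ).1) hφ, mul_ite, mul_one,
          mul_zero]
      rw [Finset.sum_congr rfl h2, Finset.sum_ite_eq]
      split_ifs with h3
      · rfl
      · by_contra h4
        exact h4 (by rw [ha φ hφ fun h => h3 (by simp [hφ, h]), sub_self])
    simp only [m, Finsupp.add_apply, Finsupp.smul_apply, Finsupp.finsetSum_apply, smul_eq_mul,
      cocharRec_single_apply, translate_incl, hβ, hφ, not_true, if_true, if_false, h1]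
    ring

end CMType

end CM

/-! ### Coordinates over a `ℚ̄`-algebra -/

section Coordinates

variable {A : Type v} [CommRing A] [Algebra ℚ A]
variable {K : Type w} [Field K] [Algebra ℚ K]

theorem coord_bc {A' : Type*} [CommRing A'] [Algebra ℚ A'] (ι : Qbar →ₐ[ℚ] A) (f : A →ₐ[ℚ] A')
    (φ : K →ₐ[ℚ] Qbar) (z : A ⊗[ℚ] K) : coord (f.comp ι) φ (bc K f z) = f (coord ι φ z) := by
  induction z with
  | zero => simp
  | tmul a k => simp
  | add x y hx hy => simp only [map_add, hx, hy]

theorem bc_comp_apply {A' : Type*} [CommRing A'] [Algebra ℚ A'] {A'' : Type*} [CommRing A'']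
    [Algebra ℚ A''] (f : A →ₐ[ℚ] A') (g : A' →ₐ[ℚ] A'') (z : A ⊗[ℚ] K) :
    bc K (g.comp f) z = bc K g (bc K f z) := by
  induction z with
  | zero => simp
  | tmul a k => simp
  | add x y hx hy => simp only [map_add, hx, hy]

variable [FiniteDimensional ℚ K]

/-- The coordinates `A ⊗ K → ∏_φ A` are injective; together with `exists_coord_eq`, this is
`A ⊗ K = ∏_φ A`. -/
theorem coord_ext (ι : Qbar →ₐ[ℚ] A) {z z' : A ⊗[ℚ] K}
    (h : ∀ φ, coord ι φ z = coord ι φ z') : z = z' := by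
  classical
  obtain ⟨b', hb', -⟩ := exists_dual K
  let B := Algebra.TensorProduct.basis A (Module.finBasis ℚ K)
  -- the dual basis recovers the components of `y` from its coordinates
  have key : ∀ (y : A ⊗[ℚ] K) (j), B.repr y j = ∑ φ, ι (φ (b' j)) * coord ι φ y := by
    intro y j
    have h1 : ∀ φ : K →ₐ[ℚ] Qbar,
        coord ι φ y = ∑ i, B.repr y i * ι (φ (Module.finBasis ℚ K i)) := by
      intro φ
      conv_lhs => rw [← B.sum_repr y]
      rw [map_sum]
      refine Finset.sum_congr rfl fun i _ => ?_
      simp [B, TensorProduct.smul_tmul']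
    have h2 : ∀ i, ∑ φ : K →ₐ[ℚ] Qbar, ι (φ (b' j)) * ι (φ (Module.finBasis ℚ K i)) =
        if j = i then 1 else 0 := by
      intro i
      have h4 := congrArg ι (hb' j i)
      rw [map_sum, apply_ite ι, map_one, map_zero] at h4
      simpa using h4
    simp_rw [h1, Finset.mul_sum]
    rw [Finset.sum_comm]
    have h3 : ∀ i, ∑ φ : K →ₐ[ℚ] Qbar,
        ι (φ (b' j)) * (B.repr y i * ι (φ (Module.finBasis ℚ K i)))
          = if j = i then B.repr y i else 0 := fun i => by
      rw [← mul_one (B.repr y i), ← mul_zero (B.repr y i), ← mul_ite, ← h2, Finset.mul_sum]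
      exact Finset.sum_congr rfl fun φ _ => by ring
    simp_rw [h3]
    simp
  apply B.repr.injective
  ext j
  rw [key, key]
  simp_rw [h]

theorem exists_coord_eq (ι : Qbar →ₐ[ℚ] A) (c : (K →ₐ[ℚ] Qbar) → A) :
    ∃ z : A ⊗[ℚ] K, ∀ φ, coord ι φ z = c φ := by
  classical
  obtain ⟨b', -, hb⟩ := exists_dual K
  refine ⟨∑ ψ, ∑ i, (c ψ * ι (ψ (b' i))) ⊗ₜ Module.finBasis ℚ K i, fun φ => ?_⟩
  have h : ∀ ψ, ∑ i, c ψ * ι (ψ (b' i)) * ι (φ (Module.finBasis ℚ K i))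
      = if φ = ψ then c ψ else 0 := by
    intro ψ
    have h1 : ∑ i, c ψ * ι (ψ (b' i)) * ι (φ (Module.finBasis ℚ K i))
        = c ψ * ι (∑ i, φ (Module.finBasis ℚ K i) * ψ (b' i)) := by
      rw [map_sum, Finset.mul_sum]
      exact Finset.sum_congr rfl fun i _ => by rw [map_mul]; ring
    rw [h1]
    split_ifs with h2
    · rw [(hb φ ψ).1 h2, map_one, mul_one]
    · rw [(hb φ ψ).2 h2, map_zero, mul_zero]
  simp_rw [map_sum, coord_tmul, h]
  simp

theorem exists_unit_coord_eq (ι : Qbar →ₐ[ℚ] A) (c : (K →ₐ[ℚ] Qbar) → Aˣ) :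
    ∃ z : (A ⊗[ℚ] K)ˣ, ∀ φ, coord ι φ (z : A ⊗[ℚ] K) = c φ := by
  obtain ⟨y, hy⟩ := exists_coord_eq ι fun φ => (c φ : A)
  obtain ⟨y', hy'⟩ := exists_coord_eq ι fun φ => ((c φ)⁻¹ : Aˣ).1
  have h : y * y' = 1 := coord_ext ι fun φ => by rw [map_mul, hy, hy', map_one, Units.mul_inv]
  exact ⟨⟨y, y', h, by rw [mul_comm, h]⟩, hy⟩

end Coordinates

namespace CMType

variable {E : Type u} [Field E] [NumberField E] [IsCMField E] (Φ : CMType E)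

/-! ### The characters of the kernel -/

open Classical in
/-- The map `X^*(R_E) → X^*(R_{E'})` transposed to `Φ.cocharRec`: it sends `[φ]` to
`∑_{β : φ ∈ βΦ} [β]`.  Characters are written in the basis dual to that of the cocharacters. -/
noncomputable def charRec : Cochar E →ₗ[ℤ] Cochar Φ.ReflexField :=
  Finsupp.linearCombination ℤ fun φ => ∑ β with φ ∈ Φ.translate β, Finsupp.single β 1

theorem charRec_apply (w : Cochar E) (β : Φ.ReflexField →ₐ[ℚ] Qbar) :
    Φ.charRec w β = Finsupp.linearCombination ℤ w (Φ.cocharRec (Finsupp.single β 1)) := by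
  classical
  rw [charRec, Finsupp.linearCombination_apply, Finsupp.linearCombination_apply,
    Finsupp.sum_fintype _ _ (by simp), Finsupp.sum_fintype _ _ (by simp),
    Finsupp.finsetSum_apply]
  refine Finset.sum_congr rfl fun φ _ => ?_
  rw [cocharRec_single_apply, Finsupp.smul_apply, Finsupp.finsetSum_apply, Finset.sum_filter]
  rw [Finset.sum_eq_single β (by simp +contextual) (by simp)]
  simp

/-- If `L_μ` is a direct summand of `X_*(R_E)`, then the image of the transposed map is
saturated: divide by `k` a functional on `L_μ`, and extend it to `X_*(R_E)`. -/
theorem mem_range_charRec_of_smul_mem (h : Φ.Lmu = Φ.LmuSat) {k : ℤ} (hk : k ≠ 0)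
    {m : Cochar Φ.ReflexField} (hm : k • m ∈ LinearMap.range Φ.charRec) :
    m ∈ LinearMap.range Φ.charRec := by
  obtain ⟨w, hw⟩ := hm
  have : Module.IsTorsionFree ℤ (Cochar E ⧸ Φ.Lmu) := by
    refine .of_smul_eq_zero fun c x hx => ?_
    induction x using Submodule.Quotient.induction_on with
    | H n =>
      rw [or_iff_not_imp_left]
      intro hc
      rw [← Submodule.Quotient.mk_smul, Submodule.Quotient.mk_eq_zero] at hx
      rw [Submodule.Quotient.mk_eq_zero]
      exact Φ.mem_Lmu_of_smul_mem h hc hx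
  have : Module.Free ℤ (Cochar E ⧸ Φ.Lmu) := Module.free_of_finite_type_torsion_free'
  obtain ⟨s, hs⟩ := Module.projective_lifting_property Φ.Lmu.mkQ LinearMap.id
    (Submodule.mkQ_surjective _)
  -- a projection of `X_*(R_E)` onto `L_μ`
  let p : Cochar E →ₗ[ℤ] Cochar E := LinearMap.id - s ∘ₗ Φ.Lmu.mkQ
  have hp : ∀ n, p n ∈ Φ.Lmu := fun n => by
    have h1 : Φ.Lmu.mkQ (s (Φ.Lmu.mkQ n)) = Φ.Lmu.mkQ n := LinearMap.congr_fun hs _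
    rw [← Submodule.Quotient.mk_eq_zero, ← Submodule.mkQ_apply]
    simp only [p, LinearMap.sub_apply, LinearMap.id_apply, LinearMap.comp_apply, map_sub, h1,
      sub_self]
  have hp' : ∀ n ∈ Φ.Lmu, p n = n := fun n hn => by
    have h1 : Φ.Lmu.mkQ n = 0 := (Submodule.Quotient.mk_eq_zero _).2 hn
    simp only [p, LinearMap.sub_apply, LinearMap.id_apply, LinearMap.comp_apply, h1, map_zero,
      sub_zero]
  let W : Cochar E →ₗ[ℤ] ℤ := Finsupp.linearCombination ℤ w
  have hW : ∀ β, W (Φ.cocharRec (Finsupp.single β 1)) = k * m β := fun β => by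
    rw [← charRec_apply, hw, Finsupp.smul_apply, smul_eq_mul]
  have hdvd : ∀ n ∈ Φ.Lmu, k ∣ W n := by
    intro n hn
    rw [Lmu_eq_span] at hn
    induction hn using Submodule.span_induction with
    | mem x hx => obtain ⟨β, rfl⟩ := hx; exact ⟨m β, hW β⟩
    | zero => simp
    | add x y _ _ hx hy => rw [map_add]; exact dvd_add hx hy
    | smul a x _ hx => rw [map_smul]; exact hx.mul_left a
  choose v hv using fun φ : E →ₐ[ℚ] Qbar => hdvd _ (hp (Finsupp.single φ 1))
  let v' : Cochar E := Finsupp.equivFunOnFinite.symm v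
  have hv' : k • Finsupp.linearCombination ℤ v' = W ∘ₗ p := by
    ext φ
    simp [v', hv φ]
  refine ⟨v', Finsupp.ext fun β => mul_left_cancel₀ hk ?_⟩
  have h2 := LinearMap.congr_fun hv' (Φ.cocharRec (Finsupp.single β 1))
  rw [LinearMap.comp_apply, hp' _ (Φ.cocharRec_single_mem β), hW] at h2
  rw [charRec_apply]
  exact h2

/-- The character group `X^*(ker r)`: the cokernel of `X^*(r)`. -/
abbrev KerChar : Type := Cochar Φ.ReflexField ⧸ LinearMap.range Φ.charRec

theorem isAddTorsionFree_kerChar (h : Φ.Lmu = Φ.LmuSat) : IsAddTorsionFree Φ.KerChar := by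
  have : Module.IsTorsionFree ℤ Φ.KerChar := by
    refine .of_smul_eq_zero fun c x hx => ?_
    induction x using Submodule.Quotient.induction_on with
    | H n =>
      rw [or_iff_not_imp_left]
      intro hc
      rw [← Submodule.Quotient.mk_smul, Submodule.Quotient.mk_eq_zero] at hx
      rw [Submodule.Quotient.mk_eq_zero]
      exact Φ.mem_range_charRec_of_smul_mem h hc hx
  exact Module.isTorsionFree_int_iff_isAddTorsionFree.mp this

theorem isDomain_kerChar (h : Φ.Lmu = Φ.LmuSat) : IsDomain (AddMonoidAlgebra Qbar Φ.KerChar) := by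
  have := Φ.isAddTorsionFree_kerChar h
  have : AddMonoid.FG Φ.KerChar :=
    AddGroup.fg_iff_addMonoid_fg.1 (Module.Finite.iff_addGroup_fg.1 inferInstance)
  infer_instance

/-- The inclusion of the group `Φ.KerChar` in the units of its group algebra. -/
noncomputable def kerCharUnits :
    Φ.KerChar →+ Additive (AddMonoidAlgebra Qbar Φ.KerChar)ˣ :=
  MonoidHom.toAdditiveRight
    ((Units.map (AddMonoidAlgebra.of Qbar Φ.KerChar)).comp toUnits.toMonoidHom)

theorem val_kerCharUnits (χ : Φ.KerChar) :
    ((Φ.kerCharUnits χ).toMul : AddMonoidAlgebra Qbar Φ.KerChar)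
      = AddMonoidAlgebra.of Qbar Φ.KerChar (Multiplicative.ofAdd χ) := rfl

/-- A point `x` with coordinates `x_β` is in the kernel of `r` if and only if the homomorphism
`X^*(R_{E'}) → Aˣ`, `[β] ↦ x_β`, is trivial on the image of `X^*(r)`. -/
theorem mem_ker_recPoints_iff_charRec {A : Type v} [CommRing A] [Algebra ℚ A] (ι : Qbar →ₐ[ℚ] A)
    (x : (A ⊗[ℚ] Φ.ReflexField)ˣ) (c : (Φ.ReflexField →ₐ[ℚ] Qbar) → Aˣ)
    (hc : ∀ β, coord ι β (x : A ⊗[ℚ] Φ.ReflexField) = c β) :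
    x ∈ (Φ.recPoints A).ker ↔
      LinearMap.range Φ.charRec ≤ LinearMap.ker (Finsupp.linearCombination ℤ
        fun β => Additive.ofMul (c β)) := by
  classical
  have h1 : ∀ φ, coord ι φ (Φ.recPoints A x : A ⊗[ℚ] E)
      = (∏ β with φ ∈ Φ.translate β, c β : Aˣ) := fun φ => by
    rw [coord_recPoints, Units.coe_prod]
    exact Finset.prod_congr (by congr) fun β _ => hc β
  have h2 : ∀ φ, Finsupp.linearCombination ℤ (fun β => Additive.ofMul (c β))
      (Φ.charRec (Finsupp.single φ 1))
        = Additive.ofMul (∏ β with φ ∈ Φ.translate β, c β) := fun φ => by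
    rw [charRec, Finsupp.linearCombination_single, one_smul, map_sum, ofMul_prod]
    refine Finset.sum_congr (by congr) fun β _ => ?_
    simp
  rw [MonoidHom.mem_ker, Units.ext_iff]
  constructor
  · intro hx
    rw [LinearMap.range_le_ker_iff]
    ext φ
    have h3 := h1 φ
    rw [hx, Units.val_one, map_one] at h3
    have h4 := h2 φ
    have h5 : 1 = ∏ β with φ ∈ Φ.translate β, c β := Units.ext h3
    rw [← h5] at h4
    simpa using h4
  · intro hx
    refine coord_ext ι fun φ => ?_
    rw [h1, Units.val_one, map_one]
    have h3 : Finsupp.linearCombination ℤ (fun β => Additive.ofMul (c β))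
      (Φ.charRec (Finsupp.single φ 1)) = 0 := hx ⟨_, rfl⟩
    rw [h2] at h3
    rw [ofMul_eq_zero.1 h3, Units.val_one]

/-- Over `ℚ̄`, the kernel of `r` is the diagonalizable group with character group `Φ.KerChar`:
there is a point with coordinates in `ℚ̄[Φ.KerChar]` of which all points are specializations. -/
theorem exists_generic_point :
    ∃ y ∈ (Φ.recPoints (AddMonoidAlgebra Qbar Φ.KerChar)).ker,
      ∀ (A : Type v) [CommRing A] [Algebra ℚ A] (_ : Qbar →ₐ[ℚ] A),
        ∀ x ∈ (Φ.recPoints A).ker, ∃ f : AddMonoidAlgebra Qbar Φ.KerChar →ₐ[ℚ] A,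
          bc Φ.ReflexField f (y : AddMonoidAlgebra Qbar Φ.KerChar ⊗[ℚ] Φ.ReflexField) = x := by
  let j : Qbar →ₐ[ℚ] AddMonoidAlgebra Qbar Φ.KerChar :=
    IsScalarTower.toAlgHom ℚ Qbar (AddMonoidAlgebra Qbar Φ.KerChar)
  obtain ⟨y, hy⟩ := exists_unit_coord_eq j fun β =>
    (Φ.kerCharUnits (Submodule.Quotient.mk (Finsupp.single β 1))).toMul
  refine ⟨y, ?_, ?_⟩
  · rw [Φ.mem_ker_recPoints_iff_charRec j y _ hy]
    -- the homomorphism `[β] ↦ x_β` factors through `Φ.KerChar` by construction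
    have h : (Finsupp.linearCombination ℤ fun β => Additive.ofMul
        (Φ.kerCharUnits (Submodule.Quotient.mk (Finsupp.single β 1))).toMul)
          = Φ.kerCharUnits.toIntLinearMap ∘ₗ (LinearMap.range Φ.charRec).mkQ := by
      ext β : 2
      simp
    rw [h]
    rintro n hn
    rw [LinearMap.mem_ker, LinearMap.comp_apply, Submodule.mkQ_apply,
      (Submodule.Quotient.mk_eq_zero _).2 hn, map_zero]
  · intro A _ _ ι x hx
    let _ : Algebra Qbar A := ι.toRingHom.toAlgebra
    have : IsScalarTower ℚ Qbar A := IsScalarTower.of_algHom ι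
    let c : (Φ.ReflexField →ₐ[ℚ] Qbar) → Aˣ := fun β => Units.map (coord ι β).toMonoidHom x
    have hx' := (Φ.mem_ker_recPoints_iff_charRec ι x c fun _ => rfl).1 hx
    let l : Φ.KerChar →ₗ[ℤ] Additive Aˣ := Submodule.liftQ _ _ hx'
    let f : AddMonoidAlgebra Qbar Φ.KerChar →ₐ[Qbar] A := AddMonoidAlgebra.lift Qbar A Φ.KerChar
      ((Units.coeHom A).comp (AddMonoidHom.toMultiplicativeLeft l.toAddMonoidHom))
    have hf : (f.restrictScalars ℚ).comp j = ι := AlgHom.ext fun a => f.commutes a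
    refine ⟨f.restrictScalars ℚ, coord_ext ι fun β => ?_⟩
    conv_lhs => rw [← hf]
    rw [coord_bc, hy, val_kerCharUnits]
    refine (AddMonoidAlgebra.lift_of _ _).trans ?_
    change ((l (Submodule.Quotient.mk (Finsupp.single β 1))).toMul : A) = _
    simp [l, c]

/-! ### The coordinate ring of the kernel -/

section Points

variable (A : Type v) [CommRing A] [Algebra ℚ A]

/-- The extension of `Φ.recPoints A` to all elements of `A ⊗ E'`. -/
noncomputable def recHom : A ⊗[ℚ] Φ.ReflexField →* A ⊗[ℚ] E :=
  (Algebra.norm (A ⊗[ℚ] E)).comp (Φ.mu A)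

theorem mem_ker_recPoints_iff (x : (A ⊗[ℚ] Φ.ReflexField)ˣ) :
    x ∈ (Φ.recPoints A).ker ↔ Φ.recHom A x = 1 := by
  rw [MonoidHom.mem_ker, Units.ext_iff]
  rfl

variable {A} in
theorem recHom_bc {B : Type w} [CommRing B] [Algebra ℚ B] (f : A →ₐ[ℚ] B)
    (x : A ⊗[ℚ] Φ.ReflexField) :
    Φ.recHom B (bc Φ.ReflexField f x) = bc E f (Φ.recHom A x) := by
  have h1 : (bc E f).comp (inE A) = inE B := AlgHom.ext fun a => by simp
  have h2 : (bc E f).comp (inA A) = (inA B).comp f := AlgHom.ext fun a => by simp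
  have h3 : bc Φ.ReflexField (bc E f) (Φ.mu A x) = Φ.mu B (bc Φ.ReflexField f x) := by
    change bc Φ.ReflexField (bc E f) (bc Φ.ReflexField (inE A) Φ.idem
      * bc Φ.ReflexField (inA A) x + (1 - bc Φ.ReflexField (inE A) Φ.idem))
        = bc Φ.ReflexField (inE B) Φ.idem * bc Φ.ReflexField (inA B) (bc Φ.ReflexField f x)
          + (1 - bc Φ.ReflexField (inE B) Φ.idem)
    rw [map_add, map_mul, map_sub, map_one]
    simp only [← bc_comp_apply, h1, h2]
  exact (congrArg (Algebra.norm (B ⊗[ℚ] E)) h3.symm).trans (norm_bc _ _ _)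

end Points

/-- Polynomials in the components of a pair of elements of `A ⊗ E'`, in a basis of `E'`. -/
abbrev PairPoly : Type u :=
  MvPolynomial (ULift.{u} (Bool × Fin (Module.finrank ℚ Φ.ReflexField))) ℚ

/-- The generic pair of elements of `A ⊗ E'`. -/
noncomputable def genericPair (s : Bool) : Φ.PairPoly ⊗[ℚ] Φ.ReflexField :=
  ∑ i, MvPolynomial.X ⟨(s, i)⟩ ⊗ₜ Module.finBasis ℚ Φ.ReflexField i

/-- The equations `x y = 1` and `r(x) = 1` for a pair `(x, y)` of elements of `A ⊗ E'`. -/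
noncomputable def kerIdeal : Ideal Φ.PairPoly :=
  Ideal.span (Set.range ((Algebra.TensorProduct.basis Φ.PairPoly
      (Module.finBasis ℚ Φ.ReflexField)).repr (Φ.genericPair true * Φ.genericPair false - 1)) ∪
    Set.range ((Algebra.TensorProduct.basis Φ.PairPoly
      (Module.finBasis ℚ E)).repr (Φ.recHom _ (Φ.genericPair true) - 1)))

theorem bc_eq_zero_iff {R : Type*} [CommRing R] [Algebra ℚ R] {A : Type*} [CommRing A]
    [Algebra ℚ A] {K : Type*} [Field K] [Algebra ℚ K] {ι : Type*} (b : Module.Basis ι ℚ K)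
    (f : R →ₐ[ℚ] A) (z : R ⊗[ℚ] K) :
    bc K f z = 0 ↔ ∀ i, f ((Algebra.TensorProduct.basis R b).repr z i) = 0 := by
  rw [← (Algebra.TensorProduct.basis A b).repr.map_eq_zero_iff, Finsupp.ext_iff]
  simp only [repr_bc, Finsupp.zero_apply]

theorem kerIdeal_le_ker_iff {A : Type v} [CommRing A] [Algebra ℚ A] (f : Φ.PairPoly →ₐ[ℚ] A) :
    Φ.kerIdeal ≤ RingHom.ker f ↔
      bc Φ.ReflexField f (Φ.genericPair true) * bc Φ.ReflexField f (Φ.genericPair false) = 1 ∧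
        Φ.recHom A (bc Φ.ReflexField f (Φ.genericPair true)) = 1 := by
  rw [← map_mul, recHom_bc, ← sub_eq_zero (b := (1 : A ⊗[ℚ] Φ.ReflexField)),
    ← sub_eq_zero (b := (1 : A ⊗[ℚ] E)), ← map_one (bc Φ.ReflexField f), ← map_one (bc E f),
    ← map_sub, ← map_sub, bc_eq_zero_iff (Module.finBasis ℚ _),
    bc_eq_zero_iff (Module.finBasis ℚ _), kerIdeal, Ideal.span_le, Set.union_subset_iff,
    Set.range_subset_iff, Set.range_subset_iff]
  rfl

/-- The coordinate ring of the kernel of `r`. -/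
abbrev KerAlg : Type u := Φ.PairPoly ⧸ Φ.kerIdeal

theorem mkKerAlg_spec :
    bc Φ.ReflexField (Ideal.Quotient.mkₐ ℚ Φ.kerIdeal) (Φ.genericPair true)
        * bc Φ.ReflexField (Ideal.Quotient.mkₐ ℚ Φ.kerIdeal) (Φ.genericPair false) = 1 ∧
      Φ.recHom Φ.KerAlg
        (bc Φ.ReflexField (Ideal.Quotient.mkₐ ℚ Φ.kerIdeal) (Φ.genericPair true)) = 1 :=
  (Φ.kerIdeal_le_ker_iff _).1 (Ideal.Quotient.mkₐ_ker ℚ Φ.kerIdeal).ge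

/-- The universal point of the kernel of `r`. -/
noncomputable def universalPoint : (Φ.KerAlg ⊗[ℚ] Φ.ReflexField)ˣ where
  val := bc Φ.ReflexField (Ideal.Quotient.mkₐ ℚ Φ.kerIdeal) (Φ.genericPair true)
  inv := bc Φ.ReflexField (Ideal.Quotient.mkₐ ℚ Φ.kerIdeal) (Φ.genericPair false)
  val_inv := Φ.mkKerAlg_spec.1
  inv_val := (mul_comm _ _).trans Φ.mkKerAlg_spec.1

theorem universalPoint_mem : Φ.universalPoint ∈ (Φ.recPoints Φ.KerAlg).ker :=
  (Φ.mem_ker_recPoints_iff _ _).2 Φ.mkKerAlg_spec.2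

theorem bc_genericPair {A : Type v} [CommRing A] [Algebra ℚ A] (f : Φ.PairPoly →ₐ[ℚ] A)
    (s : Bool) (z : A ⊗[ℚ] Φ.ReflexField) :
    bc Φ.ReflexField f (Φ.genericPair s) = z ↔
      ∀ i, f (MvPolynomial.X ⟨(s, i)⟩) =
        (Algebra.TensorProduct.basis A (Module.finBasis ℚ Φ.ReflexField)).repr z i := by
  rw [← (Algebra.TensorProduct.basis A (Module.finBasis ℚ Φ.ReflexField)).repr.injective.eq_iff,
    Finsupp.ext_iff]
  refine forall_congr' fun i => ?_
  rw [genericPair, map_sum, map_sum, Finsupp.finsetSum_apply, Finset.sum_eq_single i]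
  · simp [Algebra.TensorProduct.basis_repr_tmul]
  · intro j _ hj
    simp [Algebra.TensorProduct.basis_repr_tmul, hj]
  · simp

/-- The uniqueness part of the universal property of `Φ.KerAlg`: a homomorphism is determined by the
images of the universal point and of its inverse. -/
theorem kerAlg_hom_ext {A : Type v} [CommRing A] [Algebra ℚ A] {f f' : Φ.KerAlg →ₐ[ℚ] A}
    (h : Units.map (bc Φ.ReflexField f).toMonoidHom Φ.universalPoint
      = Units.map (bc Φ.ReflexField f').toMonoidHom Φ.universalPoint) : f = f' := by
  have h1 : ∀ s, bc Φ.ReflexField (f.comp (Ideal.Quotient.mkₐ ℚ Φ.kerIdeal)) (Φ.genericPair s)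
      = bc Φ.ReflexField (f'.comp (Ideal.Quotient.mkₐ ℚ Φ.kerIdeal)) (Φ.genericPair s) := by
    intro s
    rw [bc_comp_apply, bc_comp_apply]
    cases s with
    | true => exact congrArg Units.val h
    | false => exact congrArg (fun t => (t⁻¹ : (A ⊗[ℚ] Φ.ReflexField)ˣ).1) h
  refine Ideal.Quotient.algHom_ext ℚ (MvPolynomial.algHom_ext ?_)
  rintro ⟨s, i⟩
  exact ((Φ.bc_genericPair _ s _).1 (h1 s) i).trans ((Φ.bc_genericPair _ s _).1 rfl i).symm

/-- Every point of the kernel of `r` is a specialization of the universal point. -/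
theorem exists_kerAlg_hom {A : Type v} [CommRing A] [Algebra ℚ A]
    {x : (A ⊗[ℚ] Φ.ReflexField)ˣ} (hx : x ∈ (Φ.recPoints A).ker) :
    ∃ f : Φ.KerAlg →ₐ[ℚ] A,
      Units.map (bc Φ.ReflexField f).toMonoidHom Φ.universalPoint = x := by
  let b := Algebra.TensorProduct.basis A (Module.finBasis ℚ Φ.ReflexField)
  let p : Bool → A ⊗[ℚ] Φ.ReflexField := fun s => bif s then x.1 else x⁻¹.1
  let f : Φ.PairPoly →ₐ[ℚ] A := MvPolynomial.aeval fun t => b.repr (p t.down.1) t.down.2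
  have hf : ∀ s, bc Φ.ReflexField f (Φ.genericPair s) = p s := fun s =>
    (Φ.bc_genericPair f s _).2 fun i => by simp [f, b]
  have h : Φ.kerIdeal ≤ RingHom.ker f := by
    rw [kerIdeal_le_ker_iff, hf, hf]
    exact ⟨x.mul_inv, (Φ.mem_ker_recPoints_iff A x).1 hx⟩
  have h' : ∀ a ∈ Φ.kerIdeal, f a = 0 := fun _ ha => RingHom.mem_ker.1 (h ha)
  refine ⟨Ideal.Quotient.liftₐ Φ.kerIdeal f h', Units.ext ?_⟩
  change bc Φ.ReflexField _ (bc Φ.ReflexField (Ideal.Quotient.mkₐ ℚ Φ.kerIdeal) _) = x.1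
  rw [← bc_comp_apply, Ideal.Quotient.liftₐ_comp]
  exact hf true

/-- The kernel of `r` is represented by `Φ.KerAlg`. -/
theorem kerFunctor_corepresentableBy :
    Nonempty ((kerFunctor Φ.reciprocity ⋙ forget CommGrpCat.{u}).CorepresentableBy
      (CommAlgCat.of ℚ Φ.KerAlg)) := by
  let F := kerFunctor Φ.reciprocity ⋙ forget CommGrpCat.{u}
  let y : F.obj (CommAlgCat.of ℚ Φ.KerAlg) :=
    ⟨Φ.universalPoint, MonoidHom.mem_ker.2 (Subtype.ext Φ.universalPoint_mem)⟩
  have hy : ∀ Y : CommAlgCat.{u} ℚ, Function.Bijective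
      fun f : CommAlgCat.of ℚ Φ.KerAlg ⟶ Y => F.map f y := by
    intro Y
    constructor
    · intro f f' h
      exact CommAlgCat.hom_ext (Φ.kerAlg_hom_ext (congrArg Subtype.val h))
    · rintro ⟨x, hx⟩
      obtain ⟨f, hf⟩ := Φ.exists_kerAlg_hom (A := Y) (x := x)
        (congrArg Subtype.val (MonoidHom.mem_ker.1 hx))
      exact ⟨CommAlgCat.ofHom f, Subtype.ext hf⟩
  exact ⟨{ homEquiv := fun {Y} => Equiv.ofBijective _ (hy Y)
           homEquiv_comp := fun g f => ConcreteCategory.congr_hom (F.map_comp f g) y }⟩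

/-! ### Connectedness of the kernel -/

/-- The generic point over `ℚ̄` embeds `Φ.KerAlg` in the group algebra of a torsion-free group. -/
theorem isDomain_kerAlg (h : Φ.Lmu = Φ.LmuSat) : IsDomain Φ.KerAlg := by
  have := Φ.isDomain_kerChar h
  obtain ⟨y, hy, hgen⟩ := Φ.exists_generic_point.{u, u}
  obtain ⟨f, hf⟩ := Φ.exists_kerAlg_hom hy
  obtain ⟨A, _, _, ι, i, hi⟩ : ∃ (A : Type u) (_ : CommRing A) (_ : Algebra ℚ A)
      (_ : Qbar →ₐ[ℚ] A) (i : Φ.KerAlg →ₐ[ℚ] A), Function.Injective i :=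
    ⟨Qbar ⊗[ℚ] Φ.KerAlg, inferInstance, inferInstance, Algebra.TensorProduct.includeLeft,
      Algebra.TensorProduct.includeRight,
      Algebra.TensorProduct.includeRight_injective (algebraMap ℚ Qbar).injective⟩
  obtain ⟨k, hk⟩ := hgen A ι (Units.map (bc Φ.ReflexField i).toMonoidHom Φ.universalPoint) (by
      rw [MonoidHom.mem_ker, Φ.recPoints_natural i, MonoidHom.mem_ker.1 Φ.universalPoint_mem, map_one])
  have hki : k.comp f = i := by
    refine Φ.kerAlg_hom_ext (Units.ext ?_)
    have hf' : bc Φ.ReflexField f Φ.universalPoint.1 = y.1 := congrArg Units.val hf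
    exact (bc_comp_apply f k _).trans ((congrArg _ hf').trans hk)
  rw [← hki] at hi
  exact (Function.Injective.of_comp hi : Function.Injective f).isDomain f.toRingHom

theorem isConnectedAffineGroup_kerFunctor (h : Φ.Lmu = Φ.LmuSat) :
    IsConnectedAffineGroup (kerFunctor Φ.reciprocity) := by
  have : IsDomain (CommAlgCat.of ℚ Φ.KerAlg) := Φ.isDomain_kerAlg h
  exact ⟨CommAlgCat.of ℚ Φ.KerAlg, Φ.kerFunctor_corepresentableBy, inferInstance⟩

end CMType

end CMTorus

/-- Let `(E, Φ)` be a CM type on a CM field of degree `2g` over `ℚ`, with `g ≤ 3`. Then the kernel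
of the reciprocity morphism `r : R_{E'} → GU_E` is connected; and `L_μ = L'_μ`. -/
theorem proposition4p7 {E : Type u} [Field E] [NumberField E] [NumberField.IsCMField E]
    (g : ℕ) (hE : Module.finrank ℚ E = 2 * g) (hg : g ≤ 3) (Φ : CMTorus.CMType E) :
    CMTorus.IsConnectedAffineGroup (CMTorus.kerFunctor Φ.reciprocity) ∧ Φ.Lmu = Φ.LmuSat := by
  have h := Φ.Lmu_eq_LmuSat hE hg
  exact ⟨Φ.isConnectedAffineGroup_kerFunctor h, h⟩
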